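/- Let $n\ge 1$ and $m\ge 0$ be integers. The Yoke graph $Y_{n,m}$ is the simple graph whose vertices are the tuples $v=(v_0,v_1,\dots,v_m,v_{m+1})\in\mathbb{Z}_n\times\{0,1\}^m\times\mathbb{Z}_n$ with $\sum_{i=0}^{m+1}v_i\equiv 0\pmod n$; two distinct vertices $u,v$ are adjacent if there is $0\le i\le m$ such that $u_j=v_j$ for all $j\notin\{i,i+1\}$ and either $u_i=v_i+1$, $u_{i+1}=v_{i+1}-1$, or $u_i=v_i-1$, $u_{i+1}=v_{i+1}+1$ (equations for the entries $0$ and $m+1$ are in $\mathbb{Z}_n$, the others in $\mathbb{Z}$). Let $\varphi,\psi,\tau$ be the automorphisms of $Y_{n,m}$ given by $$\varphi(v)=(v_0+1,v_1,\dots,v_m,v_{m+1}-1),\quad \psi(v)=(v_{m+1},v_m,\dots,v_1,v_0),\quad \tau(v)=(-v_0,1-v_1,\dots,1-v_m,-(m+v_{m+1})).$$ Let $C_2$ be the cyclic group of order $2$ and, for $k\ge1$, let $D_k=\langle g,h\mid g^k=h^2=1,\ hgh=g^{-1}\rangle$ be the dihedral group of order $2k$. **Theorem.** 1. $\mathrm{Aut}(Y_{1,3})\cong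 D_4\times C_2$. 2. For all $n\ge 1$ and $m\ge 0$ with $m\ne 2$ and $(n,m)\ne(1,3)$, $\mathrm{Aut}(Y_{n,m})=\langle\varphi,\psi,\tau\rangle$. Moreover, for all such $n,m$: - $\mathrm{Aut}(Y_{1,0})$ is trivial, and $\mathrm{Aut}(Y_{2,0})\cong\mathrm{Aut}(Y_{1,1})\cong C_2$; - $\mathrm{Aut}(Y_{n,0})\cong D_n$ if $n>2$; - $\mathrm{Aut}(Y_{1,m})\cong C_2\times C_2$ if $m>1$; - $\mathrm{Aut}(Y_{n,m})\cong D_{2n}$ if $n>1$, $m>0$ and at least one of $n,m$ is odd; - $\mathrm{Aut}(Y_{n,m})\cong D_n\times C_2$ if $n>1$, $m>0$ and both $n,m$ are even. -/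

import Mathlib

/-- The vertices of the Yoke graph `Y_{n,m}`: the tuples `(v_0, v_1, …, v_m, v_{m+1})` in
`ℤ/n × {0,1}^m × ℤ/n` with `v_0 + v_1 + ⋯ + v_{m+1} ≡ 0 (mod n)`. The entry `v_0` is `left`,
the entry `v_{m+1}` is `right`, and `v_{i+1}` is `mid i` for `i < m`. -/
@[ext]
structure YokeVertex (n m : ℕ) where
  left : ZMod n
  mid : Fin m → Fin 2
  right : ZMod n
  sum_eq_zero : left + (∑ i, ((mid i : ℕ) : ZMod n)) + right = 0

namespace YokeVertex

/-- `u.EntryEq v j d` says that `u_j = v_j + d`. The equation is read in `ℤ/n` for the two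
buckets `j = 0` and `j = m + 1`, and in `ℤ` for `1 ≤ j ≤ m`. (It is only used for
`j ≤ m + 1`.) -/
def EntryEq {n m : ℕ} (u v : YokeVertex n m) (j : ℕ) (d : ℤ) : Prop :=
  if j = 0 then u.left = v.left + (d : ZMod n)
  else if h : j - 1 < m then
    ((u.mid ⟨j - 1, h⟩ : ℕ) : ℤ) = ((v.mid ⟨j - 1, h⟩ : ℕ) : ℤ) + d
  else u.right = v.right + (d : ZMod n)

/-- `u` is obtained from `v` by shifting a unit between the entries `i` and `i + 1`, in one of
the two directions. -/
def Shift {n m : ℕ} (u v : YokeVertex n m) (i : ℕ) : Prop :=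
  (∀ j ≤ m + 1, j ≠ i → j ≠ i + 1 → u.EntryEq v j 0) ∧
    ((u.EntryEq v i 1 ∧ u.EntryEq v (i + 1) (-1)) ∨
      (u.EntryEq v i (-1) ∧ u.EntryEq v (i + 1) 1))

theorem EntryEq.neg {n m : ℕ} {u v : YokeVertex n m} {j : ℕ} {d : ℤ}
    (h : u.EntryEq v j d) : v.EntryEq u j (-d) := by
  unfold EntryEq at *
  split_ifs at * with h1 h2
  · rw [h]; push_cast; ring
  · rw [h]; ring
  · rw [h]; push_cast; ring

theorem Shift.symm {n m : ℕ} {u v : YokeVertex n m} {i : ℕ} (h : u.Shift v i) :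
    v.Shift u i := by
  obtain ⟨h0, h1⟩ := h
  refine ⟨fun j hj a b => by simpa using (h0 j hj a b).neg, ?_⟩
  rcases h1 with ⟨a, b⟩ | ⟨a, b⟩
  · exact Or.inr ⟨a.neg, by simpa using b.neg⟩
  · exact Or.inl ⟨by simpa using a.neg, b.neg⟩

end YokeVertex

/-- The Yoke graph `Y_{n,m}`, as a simple graph. (The condition `u ≠ v` only matters for
`Y_{1,0}`, which is the graph with one vertex and no loop.) -/
def yokeGraph (n m : ℕ) : SimpleGraph (YokeVertex n m) where
  Adj u v := u ≠ v ∧ ∃ i ≤ m, u.Shift v i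
  symm := ⟨fun _ _ h => ⟨h.1.symm, h.2.imp fun _ hi => ⟨hi.1, hi.2.symm⟩⟩⟩
  loopless := ⟨fun _ h => h.1 rfl⟩

/-- The automorphism group of `Y_{n,m}`; multiplication is composition of functions. -/
abbrev YokeAut (n m : ℕ) : Type := yokeGraph n m ≃g yokeGraph n m

namespace YokeVertex

/-- `φ(v_0, v_1, …, v_m, v_{m+1}) = (v_0 + 1, v_1, …, v_m, v_{m+1} - 1)`. -/
def rotate {n m : ℕ} (v : YokeVertex n m) : YokeVertex n m where
  left := v.left + 1
  mid := v.mid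
  right := v.right - 1
  sum_eq_zero := by rw [← v.sum_eq_zero]; ring

/-- The inverse of `rotate`. -/
def unrotate {n m : ℕ} (v : YokeVertex n m) : YokeVertex n m where
  left := v.left - 1
  mid := v.mid
  right := v.right + 1
  sum_eq_zero := by rw [← v.sum_eq_zero]; ring

/-- `ψ(v_0, v_1, …, v_m, v_{m+1}) = (v_{m+1}, v_m, …, v_1, v_0)`. -/
def reverse {n m : ℕ} (v : YokeVertex n m) : YokeVertex n m where
  left := v.right
  mid := fun i => v.mid i.rev
  right := v.left
  sum_eq_zero := by
    have h : ∑ i : Fin m, ((v.mid i.rev : ℕ) : ZMod n) = ∑ i, ((v.mid i : ℕ) : ZMod n) :=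
      Equiv.sum_comp Fin.revPerm fun i => ((v.mid i : ℕ) : ZMod n)
    rw [h, ← v.sum_eq_zero]; ring

theorem coe_one_sub (x : Fin 2) : (((1 - x : Fin 2) : ℕ) : ℤ) = 1 - ((x : ℕ) : ℤ) := by
  fin_cases x <;> rfl

/-- `τ(v_0, v_1, …, v_m, v_{m+1}) = (-v_0, 1 - v_1, …, 1 - v_m, -(m + v_{m+1}))`. -/
def complement {n m : ℕ} (v : YokeVertex n m) : YokeVertex n m where
  left := -v.left
  mid := fun i => 1 - v.mid i
  right := -((m : ZMod n) + v.right)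
  sum_eq_zero := by
    have h : ∀ i, (((1 - v.mid i : Fin 2) : ℕ) : ZMod n) = 1 - ((v.mid i : ℕ) : ZMod n) := by
      intro i
      have := congrArg (Int.cast : ℤ → ZMod n) (coe_one_sub (v.mid i))
      simpa using this
    simp only [h, Finset.sum_sub_distrib]
    rw [← neg_eq_zero.mpr v.sum_eq_zero]
    simp
    ring

theorem rotate_unrotate {n m : ℕ} (v : YokeVertex n m) : v.unrotate.rotate = v := by
  ext <;> simp [rotate, unrotate]

theorem unrotate_rotate {n m : ℕ} (v : YokeVertex n m) : v.rotate.unrotate = v := by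
  ext <;> simp [rotate, unrotate]

theorem reverse_reverse {n m : ℕ} (v : YokeVertex n m) : v.reverse.reverse = v := by
  ext <;> simp [reverse]

theorem complement_complement {n m : ℕ} (v : YokeVertex n m) :
    v.complement.complement = v := by
  ext <;> simp [complement]

theorem EntryEq.rotate {n m : ℕ} {u v : YokeVertex n m} {j : ℕ} {d : ℤ}
    (h : u.EntryEq v j d) : u.rotate.EntryEq v.rotate j d := by
  unfold EntryEq YokeVertex.rotate at *
  split_ifs at * with h1 h2
  · simp only [h]; ring
  · simpa using h
  · simp only [h]; ring

theorem EntryEq.unrotate {n m : ℕ} {u v : YokeVertex n m} {j : ℕ} {d : ℤ}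
    (h : u.EntryEq v j d) : u.unrotate.EntryEq v.unrotate j d := by
  unfold EntryEq YokeVertex.unrotate at *
  split_ifs at * with h1 h2
  · simp only [h]; ring
  · simpa using h
  · simp only [h]; ring

theorem EntryEq.complement {n m : ℕ} {u v : YokeVertex n m} {j : ℕ} {d : ℤ}
    (h : u.EntryEq v j d) : u.complement.EntryEq v.complement j (-d) := by
  unfold EntryEq YokeVertex.complement at *
  split_ifs at * with h1 h2
  · simp only [h]; push_cast; ring
  · simp only [coe_one_sub, h]; ring
  · simp only [h]; push_cast; ring

theorem EntryEq.reverse {n m : ℕ} {u v : YokeVertex n m} {j k : ℕ} {d : ℤ}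
    (hjk : j + k = m + 1) (h : u.EntryEq v j d) : u.reverse.EntryEq v.reverse k d := by
  unfold EntryEq YokeVertex.reverse at *
  by_cases hk : k = 0
  · have h1 : ¬ j = 0 := by omega
    have h2 : ¬ j - 1 < m := by omega
    simpa [hk, h1, h2] using h
  · by_cases hj : j = 0
    · have h2 : ¬ k - 1 < m := by omega
      simpa [hk, hj, h2] using h
    · have h1 : j - 1 < m := by omega
      have h2 : k - 1 < m := by omega
      have h3 : (⟨k - 1, h2⟩ : Fin m).rev = ⟨j - 1, h1⟩ := by
        ext; simp only [Fin.val_rev]; omega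
      simp only [hk, hj, h1, h2, h3, if_false, dif_pos] at h ⊢
      exact h

theorem Shift.rotate {n m : ℕ} {u v : YokeVertex n m} {i : ℕ} (h : u.Shift v i) :
    u.rotate.Shift v.rotate i :=
  ⟨fun j hj a b => (h.1 j hj a b).rotate,
    h.2.imp (fun h => ⟨h.1.rotate, h.2.rotate⟩) fun h => ⟨h.1.rotate, h.2.rotate⟩⟩

theorem Shift.unrotate {n m : ℕ} {u v : YokeVertex n m} {i : ℕ} (h : u.Shift v i) :
    u.unrotate.Shift v.unrotate i :=
  ⟨fun j hj a b => (h.1 j hj a b).unrotate,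
    h.2.imp (fun h => ⟨h.1.unrotate, h.2.unrotate⟩) fun h => ⟨h.1.unrotate, h.2.unrotate⟩⟩

theorem Shift.complement {n m : ℕ} {u v : YokeVertex n m} {i : ℕ} (h : u.Shift v i) :
    u.complement.Shift v.complement i := by
  refine ⟨fun j hj a b => by simpa using (h.1 j hj a b).complement, ?_⟩
  rcases h.2 with ⟨a, b⟩ | ⟨a, b⟩
  · exact Or.inr ⟨a.complement, by simpa using b.complement⟩
  · exact Or.inl ⟨by simpa using a.complement, b.complement⟩

theorem Shift.reverse {n m : ℕ} {u v : YokeVertex n m} {i : ℕ} (hi : i ≤ m)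
    (h : u.Shift v i) : u.reverse.Shift v.reverse (m - i) := by
  refine ⟨fun j hj a b => (h.1 (m + 1 - j) (by omega) (by omega) (by omega)).reverse
    (by omega), ?_⟩
  rcases h.2 with ⟨a, b⟩ | ⟨a, b⟩
  · exact Or.inr ⟨b.reverse (by omega), a.reverse (by omega)⟩
  · exact Or.inl ⟨b.reverse (by omega), a.reverse (by omega)⟩

end YokeVertex

/-- A pair of mutually inverse adjacency-preserving maps is an automorphism. -/
def YokeAut.mk' {n m : ℕ} (f g : YokeVertex n m → YokeVertex n m)
    (hgf : ∀ v, g (f v) = v) (hfg : ∀ v, f (g v) = v)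
    (hf : ∀ u v, ∀ i ≤ m, u.Shift v i → ∃ j ≤ m, (f u).Shift (f v) j)
    (hg : ∀ u v, ∀ i ≤ m, u.Shift v i → ∃ j ≤ m, (g u).Shift (g v) j) : YokeAut n m where
  toFun := f
  invFun := g
  left_inv := hgf
  right_inv := hfg
  map_rel_iff' := by
    intro u v
    have hinj : Function.Injective f := Function.LeftInverse.injective hgf
    constructor
    · rintro ⟨hne, i, hi, h⟩
      refine ⟨fun e => hne (congrArg f e), ?_⟩
      have := hg _ _ i hi h
      change ∃ j ≤ m, (g (f u)).Shift (g (f v)) j at this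
      rwa [hgf, hgf] at this
    · rintro ⟨hne, i, hi, h⟩
      exact ⟨fun e => hne (hinj e), hf _ _ i hi h⟩

/-- The automorphism `φ` (bucket rotation) of `Y_{n,m}`. -/
def yokePhi (n m : ℕ) : YokeAut n m :=
  YokeAut.mk' YokeVertex.rotate YokeVertex.unrotate YokeVertex.unrotate_rotate
    YokeVertex.rotate_unrotate (fun _ _ i hi h => ⟨i, hi, h.rotate⟩)
    (fun _ _ i hi h => ⟨i, hi, h.unrotate⟩)

/-- The automorphism `ψ` (reversal) of `Y_{n,m}`. -/
def yokePsi (n m : ℕ) : YokeAut n m :=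
  YokeAut.mk' YokeVertex.reverse YokeVertex.reverse YokeVertex.reverse_reverse
    YokeVertex.reverse_reverse (fun _ _ i hi h => ⟨m - i, by omega, h.reverse hi⟩)
    (fun _ _ i hi h => ⟨m - i, by omega, h.reverse hi⟩)

/-- The automorphism `τ` (complement) of `Y_{n,m}`. -/
def yokeTau (n m : ℕ) : YokeAut n m :=
  YokeAut.mk' YokeVertex.complement YokeVertex.complement YokeVertex.complement_complement
    YokeVertex.complement_complement (fun _ _ i hi h => ⟨i, hi, h.complement⟩)
    (fun _ _ i hi h => ⟨i, hi, h.complement⟩)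

/-- The subgroup `⟨φ, ψ, τ⟩` of the automorphism group of `Y_{n,m}`. -/
def yokeFundamental (n m : ℕ) : Subgroup (YokeAut n m) :=
  Subgroup.closure {yokePhi n m, yokePsi n m, yokeTau n m}

/-- The cyclic group of order two, written multiplicatively. -/
abbrev CyclicTwo : Type := Multiplicative (ZMod 2)

/-!
Two vertices are compared through their partial sums: an edge changes exactly one of the `m + 1`
partial sums, by `±1`. Its index is the label of the edge. Edges with distant labels span squares,
and if `n * (m + 1) > 4` (or `n = 0`) such a square is the only way to complete its corner. Hence
an automorphism that fixes a vertex and all its neighbours usually fixes all neighbours of each of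
these neighbours, and by moving ones into the left bucket one at a time this spreads from
`(0, …, 0)` to the whole graph. Since `m ≠ 2`, the degree singles out the vertices with constant
middle word, so that after composition with powers of `φ` and with `τ` an automorphism fixes
`(0, …, 0)`, and after composition with `ψ` also its two neighbours.

The isomorphism types follow from the relations between `φ`, `ψ` and `τ`: the elements
`φ ^ j * (τ * ψ)` commute with `φ`, and their squares are `φ ^ (2 * j + m)`. If `n` or `m` is odd,
one of the squares is `φ`, which yields `D_{2n}`; if `m` is even, one of them is `1`, which splits
off a factor of order two.
-/

/-! ### Partial sums and steps -/

namespace YokeVertex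

variable {n m : ℕ}

/-- The `k`-th middle entry as an integer, indexed from `0`, and `0` beyond the last one. -/
def bit (v : YokeVertex n m) (k : ℕ) : ℤ :=
  if h : k < m then ((v.mid ⟨k, h⟩ : ℕ) : ℤ) else 0

theorem bit_of_lt (v : YokeVertex n m) {k : ℕ} (h : k < m) :
    v.bit k = ((v.mid ⟨k, h⟩ : ℕ) : ℤ) :=
  dif_pos h

theorem bit_eq_zero_or_one (v : YokeVertex n m) (k : ℕ) : v.bit k = 0 ∨ v.bit k = 1 := by
  unfold bit
  split_ifs with h
  · have := (v.mid ⟨k, h⟩).isLt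
    omega
  · exact Or.inl rfl

theorem bit_nonneg (v : YokeVertex n m) (k : ℕ) : 0 ≤ v.bit k := by
  rcases v.bit_eq_zero_or_one k with h | h <;> simp [h]

theorem ext_bit {u v : YokeVertex n m} (hleft : u.left = v.left)
    (hbit : ∀ k < m, u.bit k = v.bit k) : u = v := by
  have hmid : u.mid = v.mid := by
    funext k
    have := hbit k k.isLt
    rw [bit_of_lt _ k.isLt, bit_of_lt _ k.isLt] at this
    exact Fin.ext (by exact_mod_cast this)
  refine YokeVertex.ext hleft hmid ?_
  have hu := u.sum_eq_zero
  rw [hleft, hmid] at hu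
  exact add_left_cancel (hu.trans v.sum_eq_zero.symm)

theorem sum_bit (v : YokeVertex n m) :
    v.left + ∑ k ∈ Finset.range m, ((v.bit k : ℤ) : ZMod n) + v.right = 0 := by
  rw [← v.sum_eq_zero, ← Fin.sum_univ_eq_sum_range]
  simp [bit]

/-- The partial sums of the entries of `u` are those of `v` plus `D`; here `D k` is the change of
`v_0 + ⋯ + v_k`, and only the values `D k` with `k ≤ m` matter. -/
def Displaced (u v : YokeVertex n m) (D : ℕ → ℤ) : Prop :=
  u.left = v.left + (D 0 : ZMod n) ∧ ∀ k < m, u.bit k = v.bit k + D (k + 1) - D k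

/-- Going once around a non-contractible closed walk moves each of the `m + 1` partial sums by a
nonzero multiple of `n`; the condition says that no such walk has length at most four. -/
def LongLoops (n m : ℕ) : Prop := n = 0 ∨ 4 < n * (m + 1)

namespace Displaced

variable {u v w : YokeVertex n m} {D E : ℕ → ℤ}

theorem right_eq (h : Displaced u v D) : u.right = v.right - (D m : ZMod n) := by
  have hsum : ∑ k ∈ Finset.range m, ((u.bit k : ℤ) : ZMod n) =
      ∑ k ∈ Finset.range m, ((v.bit k : ℤ) : ZMod n) + ((D m : ZMod n) - (D 0 : ZMod n)) := by
    rw [← Finset.sum_range_sub (fun k => (D k : ZMod n)), ← Finset.sum_add_distrib]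
    refine Finset.sum_congr rfl fun k hk => ?_
    rw [h.2 k (Finset.mem_range.1 hk)]
    push_cast
    ring
  have hu := u.sum_bit
  rw [hsum, h.1] at hu
  linear_combination hu - v.sum_bit

theorem trans (h : Displaced u v D) (h' : Displaced w u E) : Displaced w v (D + E) := by
  refine ⟨by rw [h'.1, h.1, Pi.add_apply]; push_cast; ring, fun k hk => ?_⟩
  rw [h'.2 k hk, h.2 k hk, Pi.add_apply, Pi.add_apply]
  ring

theorem symm (h : Displaced u v D) : Displaced v u (-D) := by
  refine ⟨by rw [h.1, Pi.neg_apply]; push_cast; ring, fun k hk => ?_⟩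
  rw [h.2 k hk, Pi.neg_apply, Pi.neg_apply]
  ring

theorem congr (h : Displaced u v D) (hDE : ∀ k ≤ m, D k = E k) : Displaced u v E :=
  ⟨by rw [h.1, hDE 0 m.zero_le], fun k hk => by rw [h.2 k hk, hDE k hk.le, hDE (k + 1) hk]⟩

theorem unique (h : Displaced u v D) (h' : Displaced w v D) : u = w :=
  ext_bit (by rw [h.1, h'.1]) fun k hk => by rw [h.2 k hk, h'.2 k hk]

theorem exists_of_bounds (v : YokeVertex n m) (D : ℕ → ℤ)
    (h : ∀ k < m, 0 ≤ v.bit k + D (k + 1) - D k ∧ v.bit k + D (k + 1) - D k ≤ 1) :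
    ∃ u, Displaced u v D := by
  let mid : Fin m → Fin 2 := fun k =>
    ⟨(v.bit k + D (k + 1) - D k).toNat, by have := h k k.isLt; omega⟩
  refine ⟨⟨v.left + D 0, mid, -(v.left + D 0 + ∑ i, ((mid i : ℕ) : ZMod n)), by ring⟩,
    rfl, fun k hk => ?_⟩
  rw [bit_of_lt _ hk]
  exact Int.toNat_of_nonneg (h k hk).1

theorem const (h : Displaced v v D) {k : ℕ} (hk : k ≤ m) : D k = D 0 := by
  induction k with
  | zero => rfl
  | succ k ih =>
    have := h.2 k hk
    have := ih (by omega)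
    omega

theorem dvd_apply_zero (h : Displaced v v D) : (n : ℤ) ∣ D 0 :=
  (ZMod.intCast_zmod_eq_zero_iff_dvd _ _).1 (by simpa using h.1)

theorem eq_zero (h : Displaced v v D) (hnm : LongLoops n m)
    (hD : ∑ k ∈ Finset.range (m + 1), |D k| ≤ 4) {k : ℕ} (hk : k ≤ m) : D k = 0 := by
  rw [h.const hk]
  by_contra h0
  rcases hnm with rfl | hnm
  · exact h0 (by simpa using h.dvd_apply_zero)
  have hle : (n : ℤ) ≤ |D 0| :=
    Int.le_of_dvd (abs_pos.2 h0) ((dvd_abs _ _).2 h.dvd_apply_zero)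
  have hsum : ∑ k ∈ Finset.range (m + 1), |D k| = ((m : ℤ) + 1) * |D 0| := by
    rw [Finset.sum_congr rfl fun k hk => by
      rw [h.const (Nat.le_of_lt_succ (Finset.mem_range.1 hk))]]
    simp
  zify at hnm
  nlinarith

theorem apply_eq (h : Displaced u v D) (h' : Displaced u v E) (hnm : LongLoops n m)
    (hDE : ∑ k ∈ Finset.range (m + 1), |D k| + ∑ k ∈ Finset.range (m + 1), |E k| ≤ 4)
    {k : ℕ} (hk : k ≤ m) : D k = E k := by
  have hloop : Displaced v v (D + -E) := h.trans h'.symm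
  refine add_neg_eq_zero.1 (hloop.eq_zero hnm (le_trans ?_ hDE) hk)
  rw [← Finset.sum_add_distrib]
  exact Finset.sum_le_sum fun k _ => (abs_add_le _ _).trans_eq (by rw [Pi.neg_apply, abs_neg])

end Displaced

theorem displaced_iff_entryEq {u v : YokeVertex n m} {D : ℕ → ℤ} (hD : D (m + 1) = 0) :
    Displaced u v D ↔ ∀ j ≤ m + 1, u.EntryEq v j (D j - if j = 0 then 0 else D (j - 1)) := by
  constructor
  · intro h j hj
    unfold EntryEq
    split_ifs with h0 hlt
    · rw [h.1, h0, sub_zero]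
    · have := h.2 _ hlt
      rw [bit_of_lt _ hlt, bit_of_lt _ hlt, show j - 1 + 1 = j by omega] at this
      linarith
    · obtain rfl : j = m + 1 := by omega
      rw [h.right_eq, hD]
      simp [sub_eq_add_neg]
  · intro h
    refine ⟨by simpa [EntryEq] using h 0 (by omega), fun k hk => ?_⟩
    have := h (k + 1) (by omega)
    simp only [EntryEq, Nat.add_eq_zero_iff, one_ne_zero, and_false, if_false,
      Nat.add_sub_cancel, hk, dif_pos] at this
    rw [bit_of_lt _ hk, bit_of_lt _ hk]
    linarith

theorem displaced_single_iff {u v : YokeVertex n m} {i : ℕ} {ε : ℤ} (hi : i ≤ m) :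
    Displaced u v (Pi.single i ε) ↔
      (∀ j ≤ m + 1, j ≠ i → j ≠ i + 1 → u.EntryEq v j 0) ∧
        u.EntryEq v i ε ∧ u.EntryEq v (i + 1) (-ε) := by
  rw [displaced_iff_entryEq (Pi.single_eq_of_ne (by omega) ε)]
  simp only [Pi.single_apply]
  constructor
  · intro h
    refine ⟨fun j hj hji hji' => ?_, ?_, ?_⟩
    · convert h j hj using 1
      split_ifs <;> omega
    · convert h i (by omega) using 1
      split_ifs <;> omega
    · convert h (i + 1) (by omega) using 1
      simp
  · rintro ⟨hfar, hi, hi'⟩ j hj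
    rcases eq_or_ne j i with rfl | hji
    · convert hi using 1
      split_ifs <;> omega
    rcases eq_or_ne j (i + 1) with rfl | hji'
    · convert hi' using 1
      simp
    · convert hfar j hj hji hji' using 1
      split_ifs <;> omega

/-- `v.Step i u` says that `u` arises from `v` by changing the `i`-th partial sum by one. -/
def Step (v : YokeVertex n m) (i : ℕ) (u : YokeVertex n m) : Prop :=
  i ≤ m ∧ ∃ ε : ℤ, (ε = 1 ∨ ε = -1) ∧ Displaced u v (Pi.single i ε)

theorem step_iff_shift {u v : YokeVertex n m} {i : ℕ} : v.Step i u ↔ i ≤ m ∧ u.Shift v i := by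
  refine and_congr_right fun hi => ?_
  simp only [displaced_single_iff hi, Shift, or_and_right, exists_or, exists_eq_left,
    neg_neg, and_or_left]

/-- The labels of the steps that `v` admits. -/
def Avail (v : YokeVertex n m) (i : ℕ) : Prop :=
  i ≤ m ∧ (0 < i → i < m → v.bit (i - 1) ≠ v.bit i)

section Sign

variable {u v : YokeVertex n m} {i : ℕ} {ε : ℤ}

theorem Displaced.sign_eq_of_pos (h : Displaced u v (Pi.single i ε)) (hε : ε ≠ 0) (hi : i ≤ m)
    (hi0 : 0 < i) : ε = 1 - 2 * v.bit (i - 1) := by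
  have hb := h.2 (i - 1) (by omega)
  rw [Nat.sub_add_cancel hi0, Pi.single_eq_same, Pi.single_eq_of_ne (by omega)] at hb
  have := u.bit_eq_zero_or_one (i - 1)
  have := v.bit_eq_zero_or_one (i - 1)
  omega

theorem Displaced.sign_eq_of_lt (h : Displaced u v (Pi.single i ε)) (hε : ε ≠ 0) (hi : i < m) :
    ε = 2 * v.bit i - 1 := by
  have hb := h.2 i hi
  rw [Pi.single_eq_same, Pi.single_eq_of_ne (by omega)] at hb
  have := u.bit_eq_zero_or_one i
  have := v.bit_eq_zero_or_one i
  omega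

end Sign

namespace Step

variable {u u' v w z : YokeVertex n m} {i j k : ℕ}

theorem symm (h : v.Step i u) : u.Step i v := by
  obtain ⟨hi, ε, hε, h⟩ := h
  exact ⟨hi, -ε, by omega, by simpa only [Pi.single_neg] using h.symm⟩

theorem reverse (h : v.Step i u) : v.reverse.Step (m - i) u.reverse := by
  rw [step_iff_shift] at h ⊢
  exact ⟨Nat.sub_le m i, h.2.reverse h.1⟩

theorem bit_eq_of_far (h : v.Step i u) (hki : k ≠ i) (hki' : k + 1 ≠ i) : u.bit k = v.bit k := by
  obtain ⟨-, ε, -, h⟩ := h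
  by_cases hk : k < m
  · rw [h.2 k hk, Pi.single_eq_of_ne hki, Pi.single_eq_of_ne hki']
    ring
  · simp only [bit, dif_neg hk]

theorem bit_eq_of_near (h : v.Step i u) (hk : k < m) (hki : k = i ∨ k + 1 = i) :
    u.bit k = 1 - v.bit k := by
  obtain ⟨-, ε, hε, h⟩ := h
  have hb := h.2 k hk
  simp only [Pi.single_apply] at hb
  have := u.bit_eq_zero_or_one k
  have := v.bit_eq_zero_or_one k
  split_ifs at hb <;> omega

theorem right_eq_of_ne (h : v.Step i u) (hi : i ≠ m) : u.right = v.right := by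
  obtain ⟨-, ε, -, h⟩ := h
  rw [h.right_eq, Pi.single_eq_of_ne hi.symm]
  simp

theorem right_eq_last (hm : 1 ≤ m) (h : v.Step m u) :
    u.right = v.right - ((1 - 2 * v.bit (m - 1) : ℤ) : ZMod n) := by
  obtain ⟨-, ε, hε, h⟩ := h
  rw [h.right_eq, Pi.single_eq_same, h.sign_eq_of_pos (by omega) le_rfl hm]

theorem ne (hm : 1 ≤ m) (h : v.Step i u) : u ≠ v := by
  rintro rfl
  have hflip : ∀ k < m, k = i ∨ k + 1 = i → False := fun k hk hki => by
    have := h.bit_eq_of_near hk hki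
    omega
  by_cases hi0 : i = 0
  · exact hflip 0 hm (by omega)
  · exact hflip (i - 1) (by have := h.1; omega) (by omega)

theorem avail (h : v.Step i u) : v.Avail i := by
  obtain ⟨hi, ε, hε, h⟩ := h
  refine ⟨hi, fun hi0 hlt => ?_⟩
  have := h.sign_eq_of_pos (by omega) hi hi0
  have := h.sign_eq_of_lt (by omega) hlt
  omega

theorem unique (hm : 1 ≤ m) (h : v.Step i u) (h' : v.Step i w) : u = w := by
  obtain ⟨hi, ε, hε, h⟩ := h
  obtain ⟨-, δ, hδ, h'⟩ := h'
  obtain rfl : ε = δ := by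
    by_cases hi0 : 0 < i
    · rw [h.sign_eq_of_pos (by omega) hi hi0, h'.sign_eq_of_pos (by omega) hi hi0]
    · rw [h.sign_eq_of_lt (by omega) (by omega), h'.sign_eq_of_lt (by omega) (by omega)]
  exact h.unique h'

theorem label_unique (hm : 2 ≤ m) (h : v.Step i u) (h' : v.Step j u) : i = j := by
  by_contra hij
  obtain ⟨hi, ε, hε, h⟩ := h
  obtain ⟨-, δ, hδ, h'⟩ := h'
  have hloop : Displaced v v (Pi.single i ε + -Pi.single j δ) := h.trans h'.symm
  obtain ⟨k, hk, hki, hkj⟩ : ∃ k ≤ m, k ≠ i ∧ k ≠ j := by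
    by_contra! hall
    have := hall 0
    have := hall 1
    have := hall 2
    omega
  have hε0 : ε = 0 := by
    simpa [hij, hki, hkj] using (hloop.const hi).trans (hloop.const hk).symm
  omega

end Step

theorem Avail.exists_step (hm : 1 ≤ m) {v : YokeVertex n m} {i : ℕ} (hi : v.Avail i) :
    ∃ u, v.Step i u := by
  obtain ⟨hi, hne⟩ := hi
  obtain ⟨ε, hε, hpos, hlt⟩ : ∃ ε : ℤ, (ε = 1 ∨ ε = -1) ∧
      (0 < i → ε = 1 - 2 * v.bit (i - 1)) ∧ (i < m → ε = 2 * v.bit i - 1) := by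
    have := v.bit_eq_zero_or_one i
    have := v.bit_eq_zero_or_one (i - 1)
    by_cases hi0 : 0 < i
    · exact ⟨1 - 2 * v.bit (i - 1), by omega, fun _ => rfl, fun hlt => by
        have := hne hi0 hlt
        omega⟩
    · exact ⟨2 * v.bit i - 1, by omega, fun h => absurd h hi0, fun _ => rfl⟩
  obtain ⟨u, hu⟩ := Displaced.exists_of_bounds v (Pi.single i ε) (by
    intro k hk
    have := v.bit_eq_zero_or_one k
    simp only [Pi.single_apply]
    split_ifs with hk1 hk2 hk2
    · omega
    · subst hk1
      have := hpos (by omega)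
      rw [Nat.add_sub_cancel] at this
      omega
    · subst hk2
      have := hlt hk
      omega
    · omega)
  exact ⟨u, hi, ε, hε, hu⟩

theorem adj_iff_step (hm : 1 ≤ m) {u v : YokeVertex n m} :
    (yokeGraph n m).Adj v u ↔ ∃ i, v.Step i u := by
  constructor
  · rintro ⟨-, i, hi, h⟩
    exact ⟨i, step_iff_shift.2 ⟨hi, h.symm⟩⟩
  · rintro ⟨i, h⟩
    exact ⟨(h.ne hm).symm, i, h.1, (step_iff_shift.1 h).2.symm⟩

theorem Step.adj (hm : 1 ≤ m) {u v : YokeVertex n m} {i : ℕ} (h : v.Step i u) :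
    (yokeGraph n m).Adj v u :=
  (adj_iff_step hm).2 ⟨i, h⟩

theorem ncard_neighborSet (hm : 2 ≤ m) (v : YokeVertex n m) :
    ((yokeGraph n m).neighborSet v).ncard = {i | v.Avail i}.ncard := by
  have hstep : ∀ {i}, (hi : v.Avail i) → v.Step i (hi.exists_step (by omega)).choose :=
    fun hi => (hi.exists_step (by omega)).choose_spec
  refine (Set.ncard_congr (fun _ hi => (Avail.exists_step (by omega) hi).choose)
    (fun _ hi => (hstep hi).adj (by omega)) (fun i j hi hj hij => ?_) fun u hu => ?_).symm
  · have hij : (Avail.exists_step (by omega) hi).choose = _ := hij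
    exact (hstep hi).label_unique hm (hij ▸ hstep hj)
  · obtain ⟨i, hi⟩ := (adj_iff_step (by omega)).1 hu
    exact ⟨i, hi.avail, (hstep hi.avail).unique (by omega) hi⟩

theorem Step.exists_commute {u v z : YokeVertex n m} {i j : ℕ} (hu : v.Step i u)
    (hz : u.Step j z) (hji : j ≠ i) (hlt : j + 1 ≠ i) (hgt : j ≠ i + 1) :
    ∃ y, v.Step j y ∧ y.Step i z := by
  obtain ⟨hi, ε, hε, hu⟩ := hu
  obtain ⟨hj, δ, hδ, hz⟩ := hz
  have hzv := hu.trans hz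
  obtain ⟨y, hy⟩ := Displaced.exists_of_bounds v (Pi.single j δ) (by
    intro k hk
    have hzk := hzv.2 k hk
    have := v.bit_eq_zero_or_one k
    have := z.bit_eq_zero_or_one k
    simp only [Pi.single_apply, Pi.add_apply] at hzk ⊢
    split_ifs at hzk ⊢ <;> omega)
  refine ⟨y, ⟨hj, δ, hδ, hy⟩, hi, ε, hε, (hy.symm.trans hzv).congr fun k _ => ?_⟩
  simp only [Pi.add_apply, Pi.neg_apply]
  ring

theorem sum_abs_single_add_single_le (s : Finset ℕ) (i j : ℕ) (x y : ℤ) :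
    ∑ k ∈ s, |(Pi.single i x + Pi.single j y : ℕ → ℤ) k| ≤ |x| + |y| := by
  have hsingle : ∀ (i : ℕ) (x : ℤ), ∑ k ∈ s, |(Pi.single i x : ℕ → ℤ) k| ≤ |x| := by
    intro i x
    simp only [Pi.single_apply, apply_ite abs, abs_zero, Finset.sum_ite_eq']
    split_ifs
    · exact le_rfl
    · exact abs_nonneg x
  refine (Finset.sum_le_sum fun k _ => abs_add_le _ _).trans ?_
  rw [Finset.sum_add_distrib]
  exact add_le_add (hsingle i x) (hsingle j y)

theorem Step.common_neighbor (hm : 1 ≤ m) (hnm : LongLoops n m) {u u' v z : YokeVertex n m}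
    {i j : ℕ} (hij : i ≠ j) (hu : v.Step i u) (hu' : v.Step j u')
    (hz : (yokeGraph n m).Adj u z) (hz' : (yokeGraph n m).Adj u' z) :
    z = v ∨ u.Step j z ∧ u'.Step i z := by
  obtain ⟨k, hk⟩ := (adj_iff_step hm).1 hz
  obtain ⟨l, hl⟩ := (adj_iff_step hm).1 hz'
  obtain ⟨-, α, hα, huz⟩ := id hk
  obtain ⟨-, β, hβ, huz'⟩ := id hl
  obtain ⟨hi, ε, hε, hvu⟩ := id hu
  obtain ⟨hj, δ, hδ, hvu'⟩ := id hu'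
  have hunit : ∀ x : ℤ, x = 1 ∨ x = -1 → |x| = 1 := by rintro x (rfl | rfl) <;> rfl
  have hdisp : ∀ t ≤ m, (Pi.single i ε + Pi.single k α : ℕ → ℤ) t =
      (Pi.single j δ + Pi.single l β : ℕ → ℤ) t := fun t ht => by
    refine (hvu.trans huz).apply_eq (hvu'.trans huz') hnm ((add_le_add
      (sum_abs_single_add_single_le ..) (sum_abs_single_add_single_le ..)).trans ?_) ht
    simp only [hunit _ hα, hunit _ hβ, hunit _ hε, hunit _ hδ]
    norm_num
  have hti := hdisp i hi
  have htj := hdisp j hj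
  simp only [Pi.add_apply, Pi.single_apply] at hti htj
  by_cases hki : k = i
  · subst hki
    exact Or.inl (hk.unique hm hu.symm)
  · obtain rfl : j = k := by split_ifs at hti htj <;> omega
    obtain rfl : i = l := by split_ifs at hti htj <;> omega
    exact Or.inr ⟨hk, hl⟩

end YokeVertex

/-! ### Rigidity -/

namespace YokeVertex

variable {n m : ℕ} {f : YokeAut n m} {u v z : YokeVertex n m} {i j : ℕ}

/-- `f` fixes `v` and all its neighbours. -/
def FixesStar (f : YokeAut n m) (v : YokeVertex n m) : Prop :=
  f v = v ∧ ∀ u, (yokeGraph n m).Adj v u → f u = u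

namespace FixesStar

theorem apply_eq_of_step (hm : 1 ≤ m) (hv : FixesStar f v) (hu : v.Step i u) : f u = u :=
  hv.2 u (hu.adj hm)

theorem conj {g : YokeAut n m} (h : FixesStar f (g v)) : FixesStar (g⁻¹ * f * g) v := by
  have happly : ∀ u, f (g u) = g u → (g⁻¹ * f * g) u = u := fun u hu => by
    rw [RelIso.mul_apply, RelIso.mul_apply, hu, RelIso.inv_apply_self]
  exact ⟨happly v h.1, fun u hu => happly u (h.2 _ (g.map_adj_iff.2 hu))⟩

/-- The square `v`, `u`, `z`, `y` has three fixed vertices, and `z` is the only neighbour of both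
`u` and `y` other than `v`. -/
theorem apply_eq_of_far (hm : 1 ≤ m) (hnm : m = 1 ∨ LongLoops n m) (hv : FixesStar f v)
    (hu : v.Step i u) (hz : u.Step j z) (hlt : j + 1 ≠ i) (hgt : j ≠ i + 1) : f z = z := by
  rcases eq_or_ne j i with rfl | hji
  · rw [hz.unique hm hu.symm, hv.1]
  have hnm : LongLoops n m := hnm.resolve_left (by have := hu.1; have := hz.1; omega)
  obtain ⟨y, hy, hyz⟩ := hu.exists_commute hz hji hlt hgt
  have hufz : (yokeGraph n m).Adj u (f z) :=
    hv.apply_eq_of_step hm hu ▸ f.map_adj_iff.2 (hz.adj hm)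
  have hyfz : (yokeGraph n m).Adj y (f z) :=
    hv.apply_eq_of_step hm hy ▸ f.map_adj_iff.2 (hyz.adj hm)
  rcases Step.common_neighbor hm hnm hji.symm hu hy hufz hyfz with hfz | ⟨hfz, -⟩
  · exact f.injective (by rw [hfz, hv.1])
  · exact hfz.unique hm hz

/-- At most one neighbour of `u` is not known to be fixed, so it is fixed as well. -/
theorem step (hm : 1 ≤ m) (hnm : m = 1 ∨ LongLoops n m) (hv : FixesStar f v) (hu : v.Step i u)
    (p : ℕ) (hp : ∀ j z, u.Step j z → j + 1 = i ∨ j = i + 1 → j ≠ p → f z = z) :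
    FixesStar f u := by
  have hfu : f u = u := hv.apply_eq_of_step hm hu
  have hne : ∀ j z, u.Step j z → j ≠ p → f z = z := by
    intro j z hz hjp
    by_cases hji : j + 1 = i ∨ j = i + 1
    · exact hp j z hz hji hjp
    · exact hv.apply_eq_of_far hm hnm hu hz (by omega) (by omega)
  refine ⟨hfu, fun z hz => ?_⟩
  obtain ⟨j, hj⟩ := (adj_iff_step hm).1 hz
  rcases eq_or_ne j p with rfl | hjp
  · have hufz : (yokeGraph n m).Adj u (f z) := hfu ▸ f.map_adj_iff.2 hz
    obtain ⟨k, hk⟩ := (adj_iff_step hm).1 hufz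
    rcases eq_or_ne k j with rfl | hkj
    · exact hk.unique hm hj
    · exact f.injective (hne k _ hk hkj)
  · exact hne j z hj hjp

end FixesStar

theorem ncard_ne_of_differ_at {α : Type*} {s t : Set α} (hs : s.Finite) (ht : t.Finite) {a : α}
    (ha : a ∈ s ↔ a ∉ t) (h : ∀ x ≠ a, x ∈ s ↔ x ∈ t) : s.ncard ≠ t.ncard := by
  wlog has : a ∈ s generalizing s t
  · exact (this ht hs (by tauto) (fun x hx => (h x hx).symm) (by tauto)).symm
  have hinsert : s = insert a t := by
    ext x
    rcases eq_or_ne x a with rfl | hx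
    · simp [has]
    · simp [hx, h x hx]
  rw [hinsert, Set.ncard_insert_of_notMem (ha.1 has) ht]
  omega

theorem finite_avail (v : YokeVertex n m) : {i | v.Avail i}.Finite :=
  (Set.finite_Iic m).subset fun _ h => h.1

theorem ncard_neighborSet_apply (f : YokeAut n m) (v : YokeVertex n m) :
    ((yokeGraph n m).neighborSet (f v)).ncard = ((yokeGraph n m).neighborSet v).ncard :=
  (Nat.card_congr (f.mapNeighborSet v)).symm

/-- The neighbours `110…` and `001…` of `010…` admit the same steps except the one labelled `3`,
which changes the entries in positions `2` and `3`. -/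
theorem ncard_neighborSet_step_zero_ne_step_two {z' : YokeVertex n m} (hm : 4 ≤ m)
    (h0 : u.bit 0 = 0) (h1 : u.bit 1 = 1) (h2 : u.bit 2 = 0) (hz : u.Step 0 z)
    (hz' : u.Step 2 z') :
    ((yokeGraph n m).neighborSet z').ncard ≠ ((yokeGraph n m).neighborSet z).ncard := by
  have hz0 := hz.bit_eq_of_near (k := 0) (by omega) (by omega)
  have hz1 := hz.bit_eq_of_far (k := 1) (by omega) (by omega)
  have hz2 := hz.bit_eq_of_far (k := 2) (by omega) (by omega)
  have hz0' := hz'.bit_eq_of_far (k := 0) (by omega) (by omega)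
  have hz1' := hz'.bit_eq_of_near (k := 1) (by omega) (by omega)
  have hz2' := hz'.bit_eq_of_near (k := 2) (by omega) (by omega)
  have htail : ∀ k, 3 ≤ k → z'.bit k = z.bit k := fun k hk => by
    rw [hz.bit_eq_of_far (by omega) (by omega), hz'.bit_eq_of_far (by omega) (by omega)]
  rw [ncard_neighborSet (by omega), ncard_neighborSet (by omega)]
  refine ncard_ne_of_differ_at (finite_avail _) (finite_avail _) (a := 3) ?_ fun i hi => ?_
  · have := htail 3 le_rfl
    have := z.bit_eq_zero_or_one 3
    simp only [Avail, Set.mem_ofPred_eq, Nat.add_one_sub_one]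
    omega
  · simp only [Avail, Set.mem_ofPred_eq]
    rcases (by omega : i = 0 ∨ i = 1 ∨ i = 2 ∨ 4 ≤ i) with rfl | rfl | rfl | hi4
    · simp only [lt_irrefl, false_imp_iff]
    · simp only [Nat.sub_self]
      omega
    · simp only [Nat.add_one_sub_one]
      omega
    · rw [htail i (by omega), htail (i - 1) (by omega)]

/-- Otherwise the square spanned at `u` by the labels `0` and `3` would be mapped to a square
spanned by the labels `2` and `3`, but such steps do not commute. -/
theorem FixesStar.not_step_two_apply {f : YokeAut n 3} {u v z : YokeVertex n 3}
    (hn : LongLoops n 3) (hv : FixesStar f v) (hu : v.Step 1 u) (hz : u.Step 0 z)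
    (h1 : u.bit 1 = 1) (h2 : u.bit 2 = 0) : ¬ u.Step 2 (f z) := by
  intro hufz
  have hm : 1 ≤ 3 := by omega
  obtain ⟨y, hy⟩ := Avail.exists_step (v := u) (i := 3) hm ⟨le_rfl, by omega⟩
  obtain ⟨t, hzt, hty⟩ := hz.symm.exists_commute hy (by omega) (by omega) (by omega)
  have hfy : f y = y := hv.apply_eq_of_far hm (Or.inr hn) hu hy (by omega) (by omega)
  rcases Step.common_neighbor hm hn (by omega) hufz hy (f.map_adj_iff.2 (hzt.adj hm))
    (hfy ▸ f.map_adj_iff.2 (hty.symm.adj hm)) with hft | ⟨-, hyt⟩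
  · obtain rfl : t = u := f.injective (by rw [hft, hv.apply_eq_of_step hm hu])
    exact absurd (hzt.label_unique (by omega) hz.symm) (by omega)
  · have hy1 := hy.bit_eq_of_far (k := 1) (by omega) (by omega)
    have hy2 := hy.bit_eq_of_near (k := 2) (by omega) (by omega)
    exact hyt.avail.2 (by omega) (by omega) (by
      rw [Nat.add_one_sub_one, hy1, hy2, h1, h2, sub_zero])

theorem FixesStar.step_one (hm : 3 ≤ m) (hnm : LongLoops n m) (hv : FixesStar f v)
    (hu : v.Step 1 u) (h0 : u.bit 0 = 0) (h1 : u.bit 1 = 1) (h2 : u.bit 2 = 0) :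
    FixesStar f u := by
  have hfu : f u = u := hv.apply_eq_of_step (by omega) hu
  refine hv.step (by omega) (Or.inr hnm) hu 2 fun j z hz hj hj2 => ?_
  obtain rfl : j = 0 := by omega
  obtain ⟨k, hk⟩ := (adj_iff_step (by omega)).1 <|
    show (yokeGraph n m).Adj u (f z) from hfu ▸ f.map_adj_iff.2 (hz.adj (by omega))
  rcases eq_or_ne k 0 with rfl | hk0
  · exact hk.unique (by omega) hz
  rcases ne_or_eq k 2 with hk2 | rfl
  · exact f.injective (hv.apply_eq_of_far (by omega) (Or.inr hnm) hu hk (by omega) (by omega))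
  exfalso
  rcases hm.eq_or_lt with rfl | hm
  · exact hv.not_step_two_apply hnm hu hz h1 h2 hk
  · exact ncard_neighborSet_step_zero_ne_step_two hm h0 h1 h2 hz hk (ncard_neighborSet_apply f z)

/-- The vertex `(-r, 0, …, 0, r)`. -/
def zeroWord (m : ℕ) (r : ZMod n) : YokeVertex n m where
  left := -r
  mid := fun _ => 0
  right := r
  sum_eq_zero := by simp

theorem bit_zeroWord (r : ZMod n) (k : ℕ) : (zeroWord m r).bit k = 0 := by
  simp [bit, zeroWord]

theorem reverse_zeroWord (r : ZMod n) : (zeroWord m r).reverse = zeroWord m (-r) := by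
  ext <;> simp [zeroWord, YokeVertex.reverse]

theorem yokePsi_zeroWord (r : ZMod n) : yokePsi n m (zeroWord m r) = zeroWord m (-r) :=
  reverse_zeroWord r

theorem eq_zeroWord {v : YokeVertex n m} (h : ∀ k < m, v.bit k = 0) :
    v = zeroWord m v.right := by
  refine ext_bit ?_ fun k hk => by rw [h k hk, bit_zeroWord]
  have hsum := v.sum_bit
  rw [Finset.sum_eq_zero fun k hk => by rw [h k (Finset.mem_range.1 hk), Int.cast_zero],
    add_zero] at hsum
  exact eq_neg_of_add_eq_zero_left hsum

/-- The sum of the positions `1, …, m` of the nonzero middle entries; the induction measure for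
moving all units into the left bucket. -/
def weight (v : YokeVertex n m) : ℤ := ∑ k ∈ Finset.range m, ((k : ℤ) + 1) * v.bit k

theorem weight_term_nonneg (v : YokeVertex n m) (k : ℕ) : 0 ≤ ((k : ℤ) + 1) * v.bit k :=
  mul_nonneg (by positivity) (v.bit_nonneg k)

theorem weight_nonneg (v : YokeVertex n m) : 0 ≤ v.weight :=
  Finset.sum_nonneg fun k _ => v.weight_term_nonneg k

theorem bit_eq_zero_of_weight_eq_zero (h : v.weight = 0) {k : ℕ} (hk : k < m) : v.bit k = 0 := by
  have hterm := (Finset.sum_eq_zero_iff_of_nonneg fun k _ => v.weight_term_nonneg k).1 h k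
    (Finset.mem_range.2 hk)
  exact (mul_eq_zero.1 hterm).resolve_left (by omega)

theorem exists_first_one (h : v.weight ≠ 0) :
    ∃ p < m, v.bit p = 1 ∧ ∀ k < p, v.bit k = 0 := by
  classical
  have hex : ∃ p, v.bit p ≠ 0 := by
    by_contra! hzero
    exact h (Finset.sum_eq_zero fun k _ => by rw [hzero k, mul_zero])
  refine ⟨Nat.find hex, ?_, (v.bit_eq_zero_or_one _).resolve_left (Nat.find_spec hex),
    fun k hk => of_not_not (Nat.find_min hex hk)⟩
  by_contra hlt
  exact Nat.find_spec hex (dif_neg hlt)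

theorem sum_range_succ_mul_sub {R : Type*} [CommRing R] (D : ℕ → R) (M : ℕ) :
    ∑ k ∈ Finset.range M, ((k : R) + 1) * (D (k + 1) - D k) =
      M * D M - ∑ k ∈ Finset.range M, D k := by
  induction M with
  | zero => simp
  | succ M ih =>
    rw [Finset.sum_range_succ, Finset.sum_range_succ, ih]
    push_cast
    ring

theorem Displaced.weight_eq {D : ℕ → ℤ} (h : Displaced u v D) :
    u.weight = v.weight + (m * D m - ∑ k ∈ Finset.range m, D k) := by
  rw [← sum_range_succ_mul_sub, weight, weight, ← Finset.sum_add_distrib]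
  refine Finset.sum_congr rfl fun k hk => ?_
  rw [h.2 k (Finset.mem_range.1 hk)]
  ring

theorem exists_step_weight_sub_one {p : ℕ} (hpm : p < m) (hp : v.bit p = 1)
    (hlt : ∀ k < p, v.bit k = 0) :
    ∃ w : YokeVertex n m, w.Step p v ∧ w.right = v.right ∧ w.weight = v.weight - 1 := by
  obtain ⟨w, hw⟩ := Displaced.exists_of_bounds v (Pi.single p 1) (by
    intro k _
    have := v.bit_eq_zero_or_one k
    have := hlt k
    simp only [Pi.single_apply]
    split_ifs with hk1 hk2 hk2
    · omega
    · omega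
    · subst hk2
      omega
    · omega)
  have hstep : v.Step p w := ⟨hpm.le, 1, Or.inl rfl, hw⟩
  refine ⟨w, hstep.symm, hstep.right_eq_of_ne hpm.ne, ?_⟩
  rw [hw.weight_eq, Pi.single_eq_of_ne hpm.ne', Finset.sum_pi_single',
    if_pos (Finset.mem_range.2 hpm)]
  ring

namespace FixesStar

theorem step_first_one (hm : 1 ≤ m) (hm2 : m ≠ 2) (hnm : m = 1 ∨ LongLoops n m)
    {w : YokeVertex n m} {p : ℕ} (hw : FixesStar f w) (hstep : w.Step p v) (hpm : p < m)
    (hp : v.bit p = 1) (hlt : ∀ k < p, v.bit k = 0) : FixesStar f v := by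
  rcases eq_or_ne p 1 with rfl | hp1
  · rcases v.bit_eq_zero_or_one 2 with hb2 | hb2
    · exact hw.step_one (by omega) (hnm.resolve_left (by omega)) hstep (hlt 0 (by omega)) hp hb2
    · refine hw.step hm hnm hstep 0 fun j z hz hj hj0 => ?_
      obtain rfl : j = 2 := by omega
      exact absurd (hp.trans hb2.symm) (hz.avail.2 (by omega) (by omega))
  · refine hw.step hm hnm hstep (p + 1) fun j z hz hj hjp => ?_
    obtain rfl : p = j + 1 := by omega
    exact absurd ((hlt (j - 1) (by omega)).trans (hlt j (by omega)).symm)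
      (hz.avail.2 (by omega) (by omega))

theorem of_zeroWord (hm : 1 ≤ m) (hm2 : m ≠ 2) (hnm : m = 1 ∨ LongLoops n m)
    (hv : FixesStar f (zeroWord m v.right)) : FixesStar f v := by
  obtain ⟨N, hN⟩ := Int.eq_ofNat_of_zero_le v.weight_nonneg
  induction N generalizing v with
  | zero => rwa [eq_zeroWord fun k hk => bit_eq_zero_of_weight_eq_zero hN hk]
  | succ N ih =>
    obtain ⟨p, hpm, hp, hlt⟩ := exists_first_one (v := v) (by omega)
    obtain ⟨w, hstep, hright, hweight⟩ := exists_step_weight_sub_one hpm hp hlt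
    exact step_first_one hm hm2 hnm (ih (by rwa [hright]) (by omega)) hstep hpm hp hlt

theorem zeroWord_add_one (hm : 1 ≤ m) (hm2 : m ≠ 2) (hnm : m = 1 ∨ LongLoops n m) {r : ZMod n}
    (hr : FixesStar f (zeroWord m r)) : FixesStar f (zeroWord m (r + 1)) := by
  obtain ⟨w, hw⟩ := Avail.exists_step (v := zeroWord m (r + 1)) (i := m) hm ⟨le_rfl, by omega⟩
  have hright : w.right = r := by
    rw [hw.right_eq_last hm, bit_zeroWord]
    simp [zeroWord]
  refine step hm hnm (of_zeroWord hm hm2 hnm (hright ▸ hr)) hw.symm (m - 1) fun j z hz hj _ => ?_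
  have := hz.1
  omega

theorem zeroWord_sub_one (hm : 1 ≤ m) (hm2 : m ≠ 2) (hnm : m = 1 ∨ LongLoops n m) {r : ZMod n}
    (hr : FixesStar f (zeroWord m r)) : FixesStar f (zeroWord m (r - 1)) := by
  have hconj : FixesStar ((yokePsi n m)⁻¹ * f * yokePsi n m) (zeroWord m (-r + 1)) :=
    zeroWord_add_one hm hm2 hnm (conj (by rwa [yokePsi_zeroWord, neg_neg]))
  have hinv : (yokePsi n m)⁻¹ (zeroWord m (r - 1)) = zeroWord m (-r + 1) := by
    rw [show r - 1 = -(-r + 1) by ring, ← yokePsi_zeroWord, RelIso.inv_apply_self]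
  have hgroup : (yokePsi n m)⁻¹⁻¹ * ((yokePsi n m)⁻¹ * f * yokePsi n m) * (yokePsi n m)⁻¹ = f := by
    group
  rw [← hgroup]
  exact conj (by rwa [hinv])

theorem eq_one (hm : 1 ≤ m) (hm2 : m ≠ 2) (hnm : m = 1 ∨ LongLoops n m)
    (h0 : FixesStar f (zeroWord m 0)) : f = 1 := by
  have hall : ∀ k : ℤ, FixesStar f (zeroWord m (k : ZMod n)) := by
    intro k
    induction k with
    | zero => simpa using h0
    | succ k ih => simpa using zeroWord_add_one hm hm2 hnm ih
    | pred k ih => simpa using zeroWord_sub_one hm hm2 hnm ih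
  ext1 v
  obtain ⟨k, hk⟩ := ZMod.intCast_surjective v.right
  exact (of_zeroWord hm hm2 hnm (hk ▸ hall k)).1

end FixesStar

end YokeVertex

/-! ### Dihedral groups and direct products -/

/-- `g` and `h` satisfy the defining relations of the rotation and the reflection of the dihedral
group of order `2 * N` and no further ones; `N = 0` is the infinite dihedral group. -/
structure IsDihedralPair {G : Type*} [Group G] (N : ℕ) (g h : G) : Prop where
  orderOf_eq : orderOf g = N
  mul_self : h * h = 1
  conj_eq_inv : h * g * h = g⁻¹
  notMem_zpowers : h ∉ Subgroup.zpowers g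

section GroupRecognition

variable {G : Type*} [Group G] {N : ℕ} {g h t ρ : G}

theorem nonempty_mulEquiv_cyclicTwo (hG : Nat.card G = 2) : Nonempty (G ≃* CyclicTwo) :=
  ⟨mulEquivOfPrimeCardEq (p := 2) hG (by simp)⟩

theorem zpow_cast_intCast_orderOf (g : G) (a : ℤ) :
    g ^ ((a : ZMod (orderOf g)).cast : ℤ) = g ^ a :=
  zpow_eq_zpow_iff_modEq.2 <| (ZMod.intCast_eq_intCast_iff _ _ _).1 <| ZMod.intCast_zmod_cast _

theorem zpow_mul_of_conj_eq_inv (hh : h * h = 1) (hgh : h * g * h = g⁻¹) (k : ℤ) :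
    g ^ k * h = h * g ^ (-k) := by
  have hinv : h⁻¹ = h := inv_eq_of_mul_eq_one_right hh
  have hconj : h * g ^ k * h = g ^ (-k) := by
    rw [zpow_neg, ← inv_zpow, ← hgh]
    conv_rhs => rw [← congrArg (h * g * ·) hinv, conj_zpow, hinv]
  rw [← hconj, mul_assoc h, ← mul_assoc h, hh, one_mul]

theorem mem_zpowers_sq_or (hx : t ∈ Subgroup.zpowers ρ) :
    t ∈ Subgroup.zpowers (ρ ^ 2) ∨ t * ρ⁻¹ ∈ Subgroup.zpowers (ρ ^ 2) := by
  obtain ⟨k, rfl⟩ := Subgroup.mem_zpowers_iff.1 hx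
  have hpow : ∀ a : ℤ, (ρ ^ 2) ^ a = ρ ^ (2 * a) := fun a => by
    rw [← zpow_natCast, ← zpow_mul, Nat.cast_ofNat]
  obtain ⟨a, rfl | rfl⟩ := k.even_or_odd'
  · exact .inl ⟨a, hpow a⟩
  · exact .inr ⟨a, by rw [zpow_add_one, mul_inv_cancel_right]; exact hpow a⟩

theorem orderOf_eq_two_mul_orderOf_sq (hρ : ρ ∉ Subgroup.zpowers (ρ ^ 2)) :
    orderOf ρ = 2 * orderOf (ρ ^ 2) := by
  have hdvd : 2 ∣ orderOf ρ := by
    by_contra hodd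
    have hcoprime : Nat.Coprime 2 (orderOf ρ) := (Nat.prime_two.coprime_iff_not_dvd).2 hodd
    obtain ⟨k, hk⟩ := exists_pow_eq_self_of_coprime hcoprime
    exact hρ ⟨k, (zpow_natCast _ _).trans hk⟩
  rw [orderOf_pow_of_dvd two_ne_zero hdvd, Nat.mul_div_cancel' hdvd]

namespace IsDihedralPair

/-- The homomorphism from the dihedral group sending `r 1` to `g` and `sr 0` to `h`. -/
def hom (H : IsDihedralPair N g h) : DihedralGroup N →* G where
  toFun
    | .r i => g ^ (i.cast : ℤ)
    | .sr i => h * g ^ (i.cast : ℤ)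
  map_one' := by
    change g ^ ((0 : ZMod N).cast : ℤ) = 1
    rw [ZMod.cast_zero, zpow_zero]
  map_mul' := by
    obtain rfl := H.orderOf_eq
    have hswap := zpow_mul_of_conj_eq_inv H.mul_self H.conj_eq_inv
    rintro (i | i) (j | j) <;> obtain ⟨a, rfl⟩ := ZMod.intCast_surjective i <;>
      obtain ⟨b, rfl⟩ := ZMod.intCast_surjective j
    · simp only [DihedralGroup.r_mul_r, ← Int.cast_add, zpow_cast_intCast_orderOf, zpow_add]
    · simp only [DihedralGroup.r_mul_sr, ← Int.cast_sub, zpow_cast_intCast_orderOf, ← mul_assoc,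
        hswap]
      rw [mul_assoc, ← zpow_add, neg_add_eq_sub]
    · simp only [DihedralGroup.sr_mul_r, ← Int.cast_add, zpow_cast_intCast_orderOf, zpow_add,
        mul_assoc]
    · simp only [DihedralGroup.sr_mul_sr, ← Int.cast_sub, zpow_cast_intCast_orderOf]
      rw [mul_assoc, ← mul_assoc _ h, hswap, ← mul_assoc, ← mul_assoc, H.mul_self, one_mul,
        ← zpow_add, neg_add_eq_sub]

theorem hom_r (H : IsDihedralPair N g h) (a : ℤ) : H.hom (.r (a : ZMod N)) = g ^ a := by
  obtain rfl := H.orderOf_eq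
  exact zpow_cast_intCast_orderOf g a

theorem hom_sr (H : IsDihedralPair N g h) (a : ℤ) : H.hom (.sr (a : ZMod N)) = h * g ^ a :=
  congrArg (h * ·) (H.hom_r a)

theorem hom_injective (H : IsDihedralPair N g h) : Function.Injective H.hom := by
  rw [injective_iff_map_eq_one]
  rintro (i | i) hi <;> obtain ⟨a, rfl⟩ := ZMod.intCast_surjective i
  · rw [hom_r, ← orderOf_dvd_iff_zpow_eq_one, H.orderOf_eq] at hi
    rw [(ZMod.intCast_zmod_eq_zero_iff_dvd _ _).2 hi, DihedralGroup.r_zero]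
  · rw [hom_sr, mul_eq_one_iff_eq_inv, ← zpow_neg] at hi
    exact absurd ⟨-a, hi.symm⟩ H.notMem_zpowers

theorem range_hom (H : IsDihedralPair N g h) : H.hom.range = Subgroup.closure {g, h} := by
  have hg : g ∈ Subgroup.closure {g, h} := Subgroup.subset_closure (by simp)
  have hh : h ∈ Subgroup.closure {g, h} := Subgroup.subset_closure (by simp)
  refine le_antisymm ?_ ((Subgroup.closure_le _).2 ?_)
  · rintro _ ⟨i | i, rfl⟩
    · exact zpow_mem hg _
    · exact mul_mem hh (zpow_mem hg _)
  · rintro x (rfl | rfl)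
    · exact ⟨_, (H.hom_r 1).trans (zpow_one _)⟩
    · exact ⟨_, (H.hom_sr 0).trans (by rw [zpow_zero, mul_one])⟩

theorem nonempty_mulEquiv (H : IsDihedralPair N g h) (htop : Subgroup.closure {g, h} = ⊤) :
    Nonempty (G ≃* DihedralGroup N) :=
  ⟨(MulEquiv.ofBijective H.hom
    ⟨H.hom_injective, MonoidHom.range_eq_top.1 (H.range_hom.trans htop)⟩).symm⟩

theorem nonempty_mulEquiv_prod (H : IsDihedralPair N g h) (ht : t * t = 1) (htg : Commute t g)
    (hth : Commute t h) (hmem : t ∉ Subgroup.closure {g, h})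
    (htop : Subgroup.closure {g, h, t} = ⊤) : Nonempty (G ≃* DihedralGroup N × CyclicTwo) := by
  have ht1 : t ≠ 1 := fun h1 => hmem (h1 ▸ one_mem _)
  have hzpowers : ∀ {x}, x ∈ Subgroup.zpowers t → x = 1 ∨ x = t := by
    intro x hx
    have hsq : t ^ 2 = 1 := (pow_two t).trans ht
    simpa [hsq, mul_inv_eq_one] using mem_zpowers_sq_or hx
  have hcomm : ∀ (x : DihedralGroup N) (y : Subgroup.zpowers t),
      Commute (H.hom x) ((Subgroup.zpowers t).subtype y) := by
    have htx : ∀ x, Commute (H.hom x) t := by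
      rintro (i | i)
      · exact (htg.zpow_right _).symm
      · exact (hth.mul_right (htg.zpow_right _)).symm
    rintro x ⟨y, hy⟩
    rcases hzpowers hy with rfl | rfl
    exacts [Commute.one_right _, htx x]
  let F := H.hom.noncommCoprod (Subgroup.zpowers t).subtype hcomm
  have hinj : Function.Injective F := by
    refine (MonoidHom.noncommCoprod_injective _ _ _).2
      ⟨H.hom_injective, Subtype.val_injective, Subgroup.disjoint_def.2 fun {x} hx hx' => ?_⟩
    rw [H.range_hom] at hx
    rw [Subgroup.range_subtype] at hx'
    exact (hzpowers hx').resolve_right fun hxt => hmem (hxt ▸ hx)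
  have hsurj : Function.Surjective F := by
    rw [← MonoidHom.range_eq_top, MonoidHom.noncommCoprod_range, H.range_hom,
      Subgroup.range_subtype, Subgroup.zpowers_eq_closure, ← Subgroup.closure_union, ← htop]
    congr 1
    ext x
    simp only [Set.mem_union, Set.mem_insert_iff, Set.mem_singleton_iff, or_assoc]
  have hcard : Nat.card (Subgroup.zpowers t) = 2 :=
    (Nat.card_zpowers t).trans (orderOf_eq_prime ((pow_two t).trans ht) ht1)
  obtain ⟨e⟩ := nonempty_mulEquiv_cyclicTwo hcard
  exact ⟨(MulEquiv.ofBijective F ⟨hinj, hsurj⟩).symm.trans ((MulEquiv.refl _).prodCongr e)⟩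

theorem of_sq_eq (H : IsDihedralPair N g h) (hsq : ρ ^ 2 = g) (hconj : h * ρ * h = ρ⁻¹)
    (hmem : ρ ∉ Subgroup.closure {g, h}) : IsDihedralPair (2 * N) ρ h := by
  have hle : Subgroup.zpowers g ≤ Subgroup.closure {g, h} :=
    Subgroup.zpowers_le.2 (Subgroup.subset_closure (by simp))
  have hh : h ∈ Subgroup.closure {g, h} := Subgroup.subset_closure (by simp)
  refine ⟨?_, H.mul_self, hconj, fun hρ => ?_⟩
  · rw [orderOf_eq_two_mul_orderOf_sq (by rw [hsq]; exact fun hρ => hmem (hle hρ)), hsq,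
      H.orderOf_eq]
  · rcases mem_zpowers_sq_or hρ with hmem' | hmem' <;> rw [hsq] at hmem'
    · exact H.notMem_zpowers hmem'
    · exact hmem (inv_mem_iff.1 ((Subgroup.mul_mem_cancel_left _ hh).1 (hle hmem')))

end IsDihedralPair

instance : IsKleinFour (CyclicTwo × CyclicTwo) where
  card_four := by simp
  exponent_two := by
    rw [Monoid.exponent_prod]
    simp

end GroupRecognition

/-- The relations satisfied by the automorphisms `φ`, `ψ`, `τ` of `Y_{n,m}`, for three elements
generating a group. -/
structure YokeRelations {G : Type*} [Group G] (n m : ℕ) (φ ψ τ : G) : Prop where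
  isDihedralPair : IsDihedralPair n φ ψ
  tau_mul_self : τ * τ = 1
  tau_conj : τ * φ * τ = φ⁻¹
  psi_mul_tau : ψ * τ = φ ^ (-m : ℤ) * (τ * ψ)
  tau_notMem : τ ∉ Subgroup.closure {φ, ψ}
  closure_eq_top : Subgroup.closure {φ, ψ, τ} = ⊤

namespace YokeRelations

variable {G : Type*} [Group G] {n m : ℕ} {φ ψ τ : G}

theorem commute (H : YokeRelations n m φ ψ τ) : Commute (τ * ψ) φ := by
  have hψ := zpow_mul_of_conj_eq_inv H.isDihedralPair.mul_self H.isDihedralPair.conj_eq_inv (-1)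
  have hτ := zpow_mul_of_conj_eq_inv H.tau_mul_self H.tau_conj 1
  simp only [zpow_one, neg_neg] at hψ hτ
  change τ * ψ * φ = φ * (τ * ψ)
  rw [← mul_assoc, hτ, mul_assoc, mul_assoc, hψ]

theorem tau_mul_psi_inv (H : YokeRelations n m φ ψ τ) : (τ * ψ)⁻¹ = ψ * τ := by
  rw [mul_inv_rev, inv_eq_of_mul_eq_one_right H.tau_mul_self,
    inv_eq_of_mul_eq_one_right H.isDihedralPair.mul_self]

theorem twist_sq (H : YokeRelations n m φ ψ τ) (j : ℤ) :
    (τ * ψ * φ ^ j) ^ 2 = φ ^ (m + 2 * j) := by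
  have hsq : (τ * ψ) ^ 2 = φ ^ (m : ℤ) := by
    have hτψ : τ * ψ = φ ^ (m : ℤ) * (τ * ψ)⁻¹ := by
      rw [H.tau_mul_psi_inv, H.psi_mul_tau, zpow_neg, mul_inv_cancel_left]
    rw [pow_two]
    exact mul_eq_of_eq_mul_inv hτψ
  rw [(H.commute.zpow_right j).mul_pow, hsq, ← zpow_natCast, ← zpow_mul, ← zpow_add, mul_comm j,
    Nat.cast_ofNat]

theorem psi_conj_twist (H : YokeRelations n m φ ψ τ) (j : ℤ) :
    ψ * (τ * ψ * φ ^ j) * ψ = (τ * ψ * φ ^ j)⁻¹ := by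
  have hψ := H.isDihedralPair.mul_self
  rw [(H.commute.zpow_right j).mul_inv, H.tau_mul_psi_inv, ← zpow_neg, mul_assoc, mul_assoc,
    zpow_mul_of_conj_eq_inv hψ H.isDihedralPair.conj_eq_inv, mul_assoc, ← mul_assoc ψ ψ, hψ,
    one_mul, mul_assoc]

theorem twist_notMem (H : YokeRelations n m φ ψ τ) (j : ℤ) :
    τ * ψ * φ ^ j ∉ Subgroup.closure {φ, ψ} := by
  have hφ : φ ∈ Subgroup.closure {φ, ψ} := Subgroup.subset_closure (by simp)
  have hψ : ψ ∈ Subgroup.closure {φ, ψ} := Subgroup.subset_closure (by simp)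
  rw [Subgroup.mul_mem_cancel_right _ (zpow_mem hφ j), Subgroup.mul_mem_cancel_right _ hψ]
  exact H.tau_notMem

theorem eq_top_of_twist_mem (H : YokeRelations n m φ ψ τ) {K : Subgroup G} {j : ℤ} (hφ : φ ∈ K)
    (hψ : ψ ∈ K) (hj : τ * ψ * φ ^ j ∈ K) : K = ⊤ := by
  rw [Subgroup.mul_mem_cancel_right _ (zpow_mem hφ j), Subgroup.mul_mem_cancel_right _ hψ] at hj
  rw [eq_top_iff, ← H.closure_eq_top, Subgroup.closure_le]
  rintro x (rfl | rfl | rfl) <;> assumption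

theorem exists_zpow_add_two_mul_eq (H : YokeRelations n m φ ψ τ) (hodd : Odd n ∨ Odd m) :
    ∃ j : ℤ, φ ^ ((m : ℤ) + 2 * j) = φ := by
  have hφ : φ ^ n = 1 := H.isDihedralPair.orderOf_eq ▸ pow_orderOf_eq_one φ
  rcases hodd with ⟨k, hk⟩ | ⟨k, hk⟩
  · refine ⟨(1 - m) * (k + 1), ?_⟩
    have hexp : (m : ℤ) + 2 * ((1 - m) * (k + 1)) = n * (1 - m) + 1 := by
      rw [hk]
      push_cast
      ring
    rw [hexp, zpow_add, zpow_mul, zpow_natCast, hφ, one_zpow, one_mul, zpow_one]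
  · refine ⟨-k, ?_⟩
    rw [show (m : ℤ) + 2 * -k = 1 by omega, zpow_one]

theorem nonempty_mulEquiv_dihedral (H : YokeRelations n m φ ψ τ) (hodd : Odd n ∨ Odd m) :
    Nonempty (G ≃* DihedralGroup (2 * n)) := by
  obtain ⟨j, hj⟩ := H.exists_zpow_add_two_mul_eq hodd
  have hsq : (τ * ψ * φ ^ j) ^ 2 = φ := (H.twist_sq j).trans hj
  refine (H.isDihedralPair.of_sq_eq hsq (H.psi_conj_twist j) (H.twist_notMem j)).nonempty_mulEquiv
    ?_
  have hmem : τ * ψ * φ ^ j ∈ Subgroup.closure {τ * ψ * φ ^ j, ψ} :=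
    Subgroup.subset_closure (by simp)
  have hφ : φ ∈ Subgroup.closure {τ * ψ * φ ^ j, ψ} := by
    simpa only [hsq] using pow_mem hmem 2
  exact H.eq_top_of_twist_mem hφ (Subgroup.subset_closure (by simp)) hmem

theorem nonempty_mulEquiv_prod (H : YokeRelations n m φ ψ τ) (heven : Even m) :
    Nonempty (G ≃* DihedralGroup n × CyclicTwo) := by
  obtain ⟨k, hk⟩ := heven
  set σ := τ * ψ * φ ^ (-k : ℤ) with hσ
  have hsq : σ * σ = 1 := by
    rw [← pow_two, H.twist_sq, show (m : ℤ) + 2 * -k = 0 by omega, zpow_zero]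
  have hcommφ : Commute σ φ := H.commute.mul_left ((Commute.refl φ).zpow_left _)
  have hψ : ψ * ψ = 1 := H.isDihedralPair.mul_self
  have hcommψ : Commute σ ψ := by
    have hconj := H.psi_conj_twist (-k)
    rw [← hσ, inv_eq_of_mul_eq_one_right hsq] at hconj
    calc σ * ψ = ψ * σ * ψ * ψ := by rw [hconj]
      _ = ψ * σ := by rw [mul_assoc, hψ, mul_one]
  exact H.isDihedralPair.nonempty_mulEquiv_prod hsq hcommφ hcommψ (H.twist_notMem _)
    (H.eq_top_of_twist_mem (j := -k) (Subgroup.subset_closure (by simp))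
      (Subgroup.subset_closure (by simp)) (Subgroup.subset_closure (by simp [hσ])))

end YokeRelations

/-! ### The automorphisms `φ`, `ψ`, `τ` -/

namespace YokeVertex

variable {n m : ℕ} {u v w : YokeVertex n m}

theorem displaced_rotate (v : YokeVertex n m) : Displaced v.rotate v 1 :=
  ⟨by simp [rotate], fun k _ => by simp [bit, rotate]⟩

theorem displaced_yokePhi_zpow (v : YokeVertex n m) (a : ℤ) :
    Displaced ((yokePhi n m ^ a) v) v (fun _ => a) := by
  induction a with
  | zero => exact ⟨by simp, fun k _ => by simp⟩
  | succ a ih =>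
    rw [add_comm, zpow_one_add]
    exact (ih.trans (displaced_rotate _)).congr fun _ _ => add_comm (a : ℤ) 1
  | pred a ih =>
    have hunrotate : ∀ v : YokeVertex n m, Displaced v.unrotate v (-1) := fun v => by
      simpa only [rotate_unrotate] using (displaced_rotate v.unrotate).symm
    rw [sub_eq_neg_add, zpow_add, zpow_neg_one]
    exact (ih.trans (hunrotate _)).congr fun _ _ => add_comm (-a : ℤ) (-1)

theorem bit_complement (v : YokeVertex n m) {k : ℕ} (hk : k < m) :
    v.complement.bit k = 1 - v.bit k := by
  rw [bit_of_lt _ hk, bit_of_lt _ hk]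
  exact coe_one_sub _

theorem bit_reverse (v : YokeVertex n m) {k : ℕ} (hk : k < m) :
    v.reverse.bit k = v.bit (m - 1 - k) := by
  rw [bit_of_lt _ hk, bit_of_lt _ (by omega)]
  have hrev : (⟨k, hk⟩ : Fin m).rev = ⟨m - 1 - k, by omega⟩ := by
    ext
    simp only [Fin.val_rev]
    omega
  simp only [reverse, hrev]

theorem yokePhi_zpow_zeroWord (r : ZMod n) (a : ℤ) :
    (yokePhi n m ^ a) (zeroWord m r) = zeroWord m (r - (a : ZMod n)) :=
  (displaced_yokePhi_zpow _ a).unique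
    ⟨by simp [zeroWord]; ring, fun k _ => by simp [bit_zeroWord]⟩

theorem yokePsi_zeroWord_zero : yokePsi n m (zeroWord m 0) = zeroWord m 0 := by
  rw [yokePsi_zeroWord, neg_zero]

theorem yokeTau_zeroWord_ne (hm : 1 ≤ m) (r s : ZMod n) :
    yokeTau n m (zeroWord m r) ≠ zeroWord m s := by
  intro h
  have hbit := bit_complement (zeroWord m r) (k := 0) hm
  rw [bit_zeroWord, show (zeroWord m r).complement = zeroWord m s from h, bit_zeroWord] at hbit
  omega

theorem exists_displaced_zeroWord : ∃ w : YokeVertex n m,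
    Displaced w (zeroWord m 0) (Pi.single 0 (-1)) :=
  Displaced.exists_of_bounds _ _ fun k _ => by
    rw [bit_zeroWord, Pi.single_eq_of_ne k.succ_ne_zero, Pi.single_apply]
    split_ifs <;> norm_num

end YokeVertex

open YokeVertex

section Relations

variable (n m : ℕ)

theorem yokePhi_pow_self : yokePhi n m ^ n = 1 := by
  ext1 v
  have hv := displaced_yokePhi_zpow v n
  rw [zpow_natCast] at hv
  exact hv.unique ⟨by simp, fun k _ => by simp⟩

theorem dvd_of_yokePhi_zpow_zeroWord {a : ℤ}
    (h : (yokePhi n m ^ a) (zeroWord m 0) = zeroWord m 0) : (n : ℤ) ∣ a := by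
  rw [yokePhi_zpow_zeroWord, zero_sub] at h
  exact (ZMod.intCast_zmod_eq_zero_iff_dvd _ _).1 (neg_eq_zero.1 (congrArg right h))

theorem orderOf_yokePhi : orderOf (yokePhi n m) = n := by
  refine Nat.dvd_antisymm (orderOf_dvd_of_pow_eq_one (yokePhi_pow_self n m)) ?_
  refine Int.natCast_dvd_natCast.1 (dvd_of_yokePhi_zpow_zeroWord n m ?_)
  rw [zpow_natCast, pow_orderOf_eq_one]
  rfl

theorem yokePsi_mul_self : yokePsi n m * yokePsi n m = 1 :=
  RelIso.ext reverse_reverse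

theorem yokeTau_mul_self : yokeTau n m * yokeTau n m = 1 :=
  RelIso.ext complement_complement

theorem yokePsi_conj : yokePsi n m * yokePhi n m * yokePsi n m = (yokePhi n m)⁻¹ := by
  ext1 v
  change v.reverse.rotate.reverse = v.unrotate
  ext <;> simp [reverse, rotate, unrotate]

theorem yokeTau_conj : yokeTau n m * yokePhi n m * yokeTau n m = (yokePhi n m)⁻¹ := by
  ext1 v
  change v.complement.rotate.complement = v.unrotate
  ext
  · simp only [complement, rotate, unrotate]
    ring
  · simp [complement, rotate, unrotate]
  · simp only [complement, rotate, unrotate]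
    ring

theorem yokePsi_mul_yokeTau :
    yokePsi n m * yokeTau n m = yokePhi n m ^ (-m : ℤ) * (yokeTau n m * yokePsi n m) := by
  ext1 v
  refine Displaced.unique (v := v.reverse.complement) ?_ (displaced_yokePhi_zpow _ _)
  change Displaced v.complement.reverse v.reverse.complement _
  refine ⟨by simp [complement, reverse], fun k hk => ?_⟩
  rw [bit_reverse _ hk, bit_complement _ (by omega), bit_complement _ hk, bit_reverse _ hk]
  ring

end Relations

section

variable {n m : ℕ}

theorem yokePsi_ne_one (hnm : 2 ≤ m ∨ n ≠ 1 ∧ (1 ≤ m ∨ n ≠ 2)) : yokePsi n m ≠ 1 := by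
  intro h
  obtain ⟨w, hw⟩ := exists_displaced_zeroWord (n := n) (m := m)
  have hfix : w.reverse = w := congrArg (fun f : YokeAut n m => f w) h
  have hleft : w.left = -1 := by simpa [zeroWord] using hw.1
  have hright : w.right = -1 := (congrArg left hfix).trans hleft
  have hm2 : m < 2 := by
    by_contra! hm2
    have hfirst : w.bit 0 = 1 := by simpa [bit_zeroWord] using hw.2 0 (by omega)
    have hlast : w.bit (m - 1) = 0 := by
      have hm : m - 1 + 1 ≠ 0 ∧ m - 1 ≠ 0 := by omega
      simpa [bit_zeroWord, hm] using hw.2 (m - 1) (by omega)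
    have hreverse := bit_reverse w (k := 0) (by omega)
    rw [hfix, hfirst, Nat.sub_zero, hlast] at hreverse
    exact one_ne_zero hreverse
  rw [hw.right_eq] at hright
  rcases Nat.eq_zero_or_pos m with rfl | hm
  · have htwo : ((2 : ℕ) : ZMod n) = 0 := by
      have hone : (1 : ZMod n) = -1 := by simpa [zeroWord] using hright
      push_cast
      linear_combination hone
    have hdvd := (ZMod.natCast_eq_zero_iff 2 n).1 htwo
    rcases (Nat.dvd_prime Nat.prime_two).1 hdvd with rfl | rfl <;> omega
  · have hn : Nontrivial (ZMod n) := ZMod.nontrivial_iff.2 (by omega)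
    simp [zeroWord, hm.ne'] at hright

theorem isDihedralPair_yokePhi_yokePsi (hnm : 2 ≤ m ∨ n ≠ 1 ∧ (1 ≤ m ∨ n ≠ 2)) :
    IsDihedralPair n (yokePhi n m) (yokePsi n m) where
  orderOf_eq := orderOf_yokePhi n m
  mul_self := yokePsi_mul_self n m
  conj_eq_inv := yokePsi_conj n m
  notMem_zpowers := by
    intro hψ
    obtain ⟨a, ha⟩ := Subgroup.mem_zpowers_iff.1 hψ
    refine yokePsi_ne_one hnm ?_
    have hdvd : (n : ℤ) ∣ a := dvd_of_yokePhi_zpow_zeroWord n m (by rw [ha, yokePsi_zeroWord_zero])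
    rw [← ha, ← orderOf_dvd_iff_zpow_eq_one, orderOf_yokePhi]
    exact hdvd

theorem yokeTau_notMem_closure (hm : 1 ≤ m) (H : IsDihedralPair n (yokePhi n m) (yokePsi n m)) :
    yokeTau n m ∉ Subgroup.closure {yokePhi n m, yokePsi n m} := by
  rw [← H.range_hom]
  rintro ⟨i | i, hi⟩ <;> obtain ⟨a, rfl⟩ := ZMod.intCast_surjective i
  · rw [H.hom_r] at hi
    exact yokeTau_zeroWord_ne hm 0 _ (by rw [← hi, yokePhi_zpow_zeroWord])
  · rw [H.hom_sr] at hi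
    exact yokeTau_zeroWord_ne hm 0 _
      (by rw [← hi, RelIso.mul_apply, yokePhi_zpow_zeroWord, yokePsi_zeroWord])

theorem yokeRelations (hnm : 2 ≤ m ∨ n ≠ 1 ∧ 1 ≤ m) (htop : yokeFundamental n m = ⊤) :
    YokeRelations n m (yokePhi n m) (yokePsi n m) (yokeTau n m) where
  isDihedralPair := isDihedralPair_yokePhi_yokePsi (by tauto)
  tau_mul_self := yokeTau_mul_self n m
  tau_conj := yokeTau_conj n m
  psi_mul_tau := yokePsi_mul_yokeTau n m
  tau_notMem := yokeTau_notMem_closure (by omega) (isDihedralPair_yokePhi_yokePsi (by tauto))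
  closure_eq_top := htop

theorem yokePhi_mem : yokePhi n m ∈ yokeFundamental n m := Subgroup.subset_closure (by simp)

theorem yokePsi_mem : yokePsi n m ∈ yokeFundamental n m := Subgroup.subset_closure (by simp)

theorem yokeTau_mem : yokeTau n m ∈ yokeFundamental n m := Subgroup.subset_closure (by simp)

end

namespace YokeVertex

variable {n m : ℕ} {f : YokeAut n m} {u w : YokeVertex n m}

theorem avail_zeroWord_iff {r : ZMod n} {i : ℕ} : (zeroWord m r).Avail i ↔ i = 0 ∨ i = m := by
  simp only [Avail, bit_zeroWord, ne_eq, not_true_eq_false, imp_false, not_lt]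
  omega

theorem bit_apply_zeroWord_eq (hm2 : m ≠ 2) (f : YokeAut n m) (r : ZMod n) {k : ℕ} (hk : k < m) :
    (f (zeroWord m r)).bit k = (f (zeroWord m r)).bit 0 := by
  rcases Nat.lt_or_ge m 2 with hm | hm
  · rw [show k = 0 by omega]
  have hsubset : {i | (zeroWord m r).Avail i} ⊆ {i | (f (zeroWord m r)).Avail i} := fun i hi => by
    rcases avail_zeroWord_iff.1 hi with rfl | rfl
    exacts [⟨by omega, by omega⟩, ⟨le_rfl, by omega⟩]
  have hcard := ncard_neighborSet_apply f (zeroWord m r)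
  rw [ncard_neighborSet hm, ncard_neighborSet hm] at hcard
  have hset := Set.eq_of_subset_of_ncard_le hsubset hcard.le (finite_avail _)
  induction k with
  | zero => rfl
  | succ k ih =>
    rw [← ih (by omega)]
    by_contra hne
    have hmem : k + 1 ∈ {i | (f (zeroWord m r)).Avail i} := ⟨by omega, fun _ _ => Ne.symm hne⟩
    rw [← hset] at hmem
    have := avail_zeroWord_iff.1 hmem
    omega

theorem exists_mul_apply_zeroWord_of_bit_eq_zero
    (hf : ∀ k < m, (f (zeroWord m 0)).bit k = 0) :
    ∃ g ∈ yokeFundamental n m, (g * f) (zeroWord m 0) = zeroWord m 0 := by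
  obtain ⟨a, ha⟩ := ZMod.intCast_surjective (f (zeroWord m 0)).right
  refine ⟨yokePhi n m ^ a, zpow_mem yokePhi_mem _, ?_⟩
  rw [RelIso.mul_apply, eq_zeroWord hf, yokePhi_zpow_zeroWord, ha, sub_self]

theorem exists_mul_apply_zeroWord (hm2 : m ≠ 2) (f : YokeAut n m) :
    ∃ g ∈ yokeFundamental n m, (g * f) (zeroWord m 0) = zeroWord m 0 := by
  rcases (f (zeroWord m 0)).bit_eq_zero_or_one 0 with h0 | h1
  · exact exists_mul_apply_zeroWord_of_bit_eq_zero fun k hk => by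
      rw [bit_apply_zeroWord_eq hm2 f 0 hk, h0]
  · obtain ⟨g, hg, hgf⟩ := exists_mul_apply_zeroWord_of_bit_eq_zero (f := yokeTau n m * f)
      fun k hk => by
        change (f (zeroWord m 0)).complement.bit k = 0
        rw [bit_complement _ hk, bit_apply_zeroWord_eq hm2 f 0 hk, h1, sub_self]
    exact ⟨g * yokeTau n m, mul_mem hg yokeTau_mem, hgf⟩

theorem yokeFundamental_eq_top_of_rigid (hm2 : m ≠ 2)
    (hw : ∀ f : YokeAut n m, f (zeroWord m 0) = zeroWord m 0 → f w = w ∨ f w = w.reverse)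
    (hrigid : ∀ f : YokeAut n m, f (zeroWord m 0) = zeroWord m 0 → f w = w → f = 1) :
    yokeFundamental n m = ⊤ := by
  rw [eq_top_iff]
  intro f _
  obtain ⟨g, hg, hgf⟩ := exists_mul_apply_zeroWord hm2 f
  refine (Subgroup.mul_mem_cancel_left _ hg).1 ?_
  rcases hw _ hgf with hfix | hreverse
  · rw [hrigid _ hgf hfix]
    exact one_mem _
  · have hone : yokePsi n m * (g * f) = 1 := by
      refine hrigid _ ?_ ?_
      · rw [RelIso.mul_apply, hgf, yokePsi_zeroWord_zero]
      · rw [RelIso.mul_apply, hreverse]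
        exact reverse_reverse w
    rw [← Subgroup.mul_mem_cancel_left _ yokePsi_mem, hone]
    exact one_mem _

theorem adj_zeroWord_zero (hm : 1 ≤ m) (hw : (zeroWord m (0 : ZMod n)).Step 0 w)
    (hu : (yokeGraph n m).Adj (zeroWord m 0) u) : u = w ∨ u = w.reverse := by
  obtain ⟨i, hi⟩ := (adj_iff_step hm).1 hu
  rcases avail_zeroWord_iff.1 hi.avail with rfl | rfl
  · exact .inl (hi.unique hm hw)
  · have hreverse := hw.reverse
    rw [reverse_zeroWord, neg_zero] at hreverse
    exact .inr (hi.unique hm hreverse)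

theorem yokeFundamental_eq_top_of_pos (hm : 1 ≤ m) (hm2 : m ≠ 2) (hnm : m = 1 ∨ LongLoops n m) :
    yokeFundamental n m = ⊤ := by
  obtain ⟨w, hw⟩ := (avail_zeroWord_iff (m := m) (r := (0 : ZMod n)).2 (.inl rfl)).exists_step hm
  have hadj : ∀ f : YokeAut n m, f (zeroWord m 0) = zeroWord m 0 → ∀ u,
      (yokeGraph n m).Adj (zeroWord m 0) u → f u = w ∨ f u = w.reverse := fun f hf u hu =>
    adj_zeroWord_zero hm hw (hf ▸ f.map_adj_iff.2 hu)
  refine yokeFundamental_eq_top_of_rigid (w := w) hm2 (fun f hf => hadj f hf w (hw.adj hm))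
    fun f hf hfw => FixesStar.eq_one hm hm2 hnm ⟨hf, fun u hu => ?_⟩
  rcases adj_zeroWord_zero hm hw hu with rfl | rfl
  · exact hfw
  · refine (hadj f hf _ hu).elim (fun hfu => ?_) id
    rw [f.injective (hfu.trans hfw.symm), hfw]

theorem zeroWord_right (v : YokeVertex n 0) : zeroWord 0 v.right = v :=
  (eq_zeroWord fun _ hk => absurd hk (Nat.not_lt_zero _)).symm

theorem displaced_zeroWord_zero_iff {r s : ZMod n} {D : ℕ → ℤ} :
    Displaced (zeroWord 0 s) (zeroWord 0 r) D ↔ s = r - (D 0 : ZMod n) := by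
  refine ⟨fun h => h.right_eq, fun h => ⟨?_, by omega⟩⟩
  simp only [zeroWord, h]
  ring

theorem adj_zeroWord_iff {r s : ZMod n} :
    (yokeGraph n 0).Adj (zeroWord 0 r) (zeroWord 0 s) ↔ r ≠ s ∧ (s = r + 1 ∨ s = r - 1) := by
  have hne : zeroWord 0 r ≠ zeroWord 0 s ↔ r ≠ s :=
    not_congr ⟨fun h => congrArg right h, fun h => congrArg _ h⟩
  refine and_congr hne ?_
  have hstep : (∃ i ≤ 0, (zeroWord 0 r).Shift (zeroWord 0 s) i) ↔
      (zeroWord 0 r).Step 0 (zeroWord 0 s) := by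
    rw [step_iff_shift]
    exact ⟨fun ⟨i, hi, h⟩ => ⟨le_rfl, Nat.le_zero.1 hi ▸ h.symm⟩, fun h => ⟨0, h.1, h.2.symm⟩⟩
  rw [hstep]
  simp only [Step, le_rfl, true_and, or_and_right, exists_or, exists_eq_left,
    displaced_zeroWord_zero_iff, Pi.single_eq_same, Int.cast_neg, Int.cast_one, sub_neg_eq_add]
  exact or_comm

theorem apply_zeroWord_of_adjacent {f : YokeAut n 0} {r s : ZMod n}
    (hr : f (zeroWord 0 r) = zeroWord 0 r) (hs : s = r + 1 ∨ s = r - 1) :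
    f (zeroWord 0 s) = zeroWord 0 (r + 1) ∨ f (zeroWord 0 s) = zeroWord 0 (r - 1) := by
  by_cases hrs : r = s
  · subst hrs
    rw [hr]
    exact hs.imp (congrArg _) (congrArg _)
  · have hadj := f.map_adj_iff.2 (adj_zeroWord_iff.2 ⟨hrs, hs⟩)
    rw [hr, ← zeroWord_right (f (zeroWord 0 s)), adj_zeroWord_iff] at hadj
    rw [← zeroWord_right (f (zeroWord 0 s))]
    exact hadj.2.imp (congrArg _) (congrArg _)

theorem apply_zeroWord_add {f : YokeAut n 0} {r ε : ZMod n} (hε : ε = 1 ∨ ε = -1)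
    (hr : f (zeroWord 0 r) = zeroWord 0 r) (hprev : f (zeroWord 0 (r - ε)) = zeroWord 0 (r - ε)) :
    f (zeroWord 0 (r + ε)) = zeroWord 0 (r + ε) := by
  have hor : f (zeroWord 0 (r + ε)) = zeroWord 0 (r + ε) ∨
      f (zeroWord 0 (r + ε)) = zeroWord 0 (r - ε) := by
    rcases hε with rfl | rfl
    · exact apply_zeroWord_of_adjacent hr (.inl rfl)
    · rw [sub_neg_eq_add, ← sub_eq_add_neg]
      exact (apply_zeroWord_of_adjacent hr (.inr rfl)).symm
  refine hor.elim id fun h => ?_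
  rw [f.injective (h.trans hprev.symm), hprev]

theorem eq_one_of_apply_zeroWord {f : YokeAut n 0} (h0 : f (zeroWord 0 0) = zeroWord 0 0)
    (h1 : f (zeroWord 0 1) = zeroWord 0 1) : f = 1 := by
  have hall : ∀ k : ℤ, f (zeroWord 0 (k : ZMod n)) = zeroWord 0 (k : ZMod n) ∧
      f (zeroWord 0 (k + 1 : ZMod n)) = zeroWord 0 (k + 1 : ZMod n) := fun k => by
    induction k with
    | zero => simpa using ⟨h0, h1⟩
    | succ k ih =>
      push_cast at ih ⊢
      exact ⟨ih.2, apply_zeroWord_add (.inl rfl) ih.2 (by simpa using ih.1)⟩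
    | pred k ih =>
      rw [Int.cast_sub, Int.cast_one, sub_add_cancel, sub_eq_add_neg]
      exact ⟨apply_zeroWord_add (.inr rfl) ih.1 (by simpa using ih.2), ih.1⟩
  ext1 v
  obtain ⟨k, hk⟩ := ZMod.intCast_surjective v.right
  rw [← zeroWord_right v, ← hk]
  exact (hall k).1

theorem yokeFundamental_eq_top_of_zero : yokeFundamental n 0 = ⊤ := by
  refine yokeFundamental_eq_top_of_rigid (w := zeroWord 0 1) (by omega) (fun f h0 => ?_)
    fun f h0 h1 => eq_one_of_apply_zeroWord h0 h1
  have hor := apply_zeroWord_of_adjacent h0 (.inl rfl)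
  rwa [zero_add, zero_sub, ← reverse_zeroWord] at hor

theorem yokeFundamental_eq_top (hm2 : m ≠ 2) (hnm : (n, m) ≠ (1, 3)) :
    yokeFundamental n m = ⊤ := by
  rcases Nat.eq_zero_or_pos m with rfl | hm
  · exact yokeFundamental_eq_top_of_zero
  refine yokeFundamental_eq_top_of_pos hm hm2 (or_iff_not_imp_left.2 fun hm1 => ?_)
  refine or_iff_not_imp_left.2 fun hn => ?_
  rcases (show 4 ≤ m ∨ m = 3 by omega) with hm4 | rfl
  · nlinarith [Nat.pos_of_ne_zero hn]
  · have hn1 : n ≠ 1 := fun h => hnm (by rw [h])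
    omega

end YokeVertex

/-! ### The graph `Y_{1,3}` -/

namespace YokeOneThree

/-- The words `100, 001, 110, 011, 000, 111, 010, 101`, which number the vertices of `Y_{1,3}`. -/
def word : Fin 8 → Fin 3 → Fin 2 :=
  ![![1, 0, 0], ![0, 0, 1], ![1, 1, 0], ![0, 1, 1], ![0, 0, 0], ![1, 1, 1], ![0, 1, 0],
    ![1, 0, 1]]

/-- The neighbours of each vertex of `Y_{1,3}`, all vertices being numbered as in `word`. -/
def nbrs : Fin 8 → Finset (Fin 8) :=
  ![{4, 6, 7}, {4, 6, 7}, {5, 6, 7}, {5, 6, 7}, {0, 1}, {2, 3}, {0, 1, 2, 3}, {0, 1, 2, 3}]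

/-- A copy of `Y_{1,3}` whose adjacency can be decided by evaluation. -/
def graph : SimpleGraph (Fin 8) where
  Adj a b := b ∈ nbrs a
  symm := ⟨by decide⟩
  loopless := ⟨by decide⟩

instance : DecidableRel graph.Adj := fun a b => inferInstanceAs (Decidable (b ∈ nbrs a))

/-- The vertex of `Y_{1,3}` with a given number. -/
def vertex (a : Fin 8) : YokeVertex 1 3 := ⟨0, word a, 0, Subsingleton.elim _ _⟩

theorem vertex_bijective : Function.Bijective vertex := by
  have hinj : Function.Injective word := by decide
  have hsurj : ∀ w : Fin 3 → Fin 2, ∃ a, word a = w := by decide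
  refine ⟨fun a b h => hinj (congrArg YokeVertex.mid h), fun v => ?_⟩
  obtain ⟨a, ha⟩ := hsurj v.mid
  exact ⟨a, YokeVertex.ext (Subsingleton.elim _ _) ha (Subsingleton.elim _ _)⟩

instance {n m : ℕ} (u v : YokeVertex n m) (j : ℕ) (d : ℤ) : Decidable (u.EntryEq v j d) := by
  unfold YokeVertex.EntryEq
  infer_instance

instance {n m : ℕ} (u v : YokeVertex n m) (i : ℕ) : Decidable (u.Shift v i) := by
  unfold YokeVertex.Shift
  infer_instance

theorem adj_vertex_iff (a b : Fin 8) :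
    (yokeGraph 1 3).Adj (vertex a) (vertex b) ↔ graph.Adj a b := by
  have hdecide : ∀ a b : Fin 8,
      (a ≠ b ∧ ∃ i < 4, (vertex a).Shift (vertex b) i) ↔ graph.Adj a b := by
    decide
  rw [← hdecide]
  refine and_congr vertex_bijective.injective.ne_iff ?_
  simp only [Nat.lt_succ_iff]

/-- The numbering of the vertices as an isomorphism of graphs. -/
noncomputable def vertexIso : graph ≃g yokeGraph 1 3 where
  toEquiv := Equiv.ofBijective vertex vertex_bijective
  map_rel_iff' := adj_vertex_iff _ _

/-- The isomorphism of automorphism groups induced by `vertexIso`. -/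
noncomputable def autEquiv : YokeAut 1 3 ≃* (graph ≃g graph) where
  toFun f := (vertexIso.trans f).trans vertexIso.symm
  invFun f := (vertexIso.symm.trans f).trans vertexIso
  left_inv f := by ext1 v; simp
  right_inv f := by ext1 v; simp
  map_mul' f g := by ext1 v; simp

/-- The rotation of order four, acting as the cycle `100 → 110 → 001 → 011 → 100`. -/
def rot : graph ≃g graph where
  toFun := ![2, 3, 1, 0, 5, 4, 6, 7]
  invFun := ![3, 2, 0, 1, 5, 4, 6, 7]
  left_inv := by decide
  right_inv := by decide
  map_rel_iff' := by decide

/-- The reflection exchanging `100` and `001`. -/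
def refl : graph ≃g graph where
  toFun := ![1, 0, 2, 3, 4, 5, 6, 7]
  invFun := ![1, 0, 2, 3, 4, 5, 6, 7]
  left_inv := by decide
  right_inv := by decide
  map_rel_iff' := by decide

/-- The central involution, exchanging `010` and `101`. -/
def swap : graph ≃g graph where
  toFun := ![0, 1, 2, 3, 4, 5, 7, 6]
  invFun := ![0, 1, 2, 3, 4, 5, 7, 6]
  left_inv := by decide
  right_inv := by decide
  map_rel_iff' := by decide

theorem orderOf_rot : orderOf rot = 4 := by
  refine orderOf_eq_prime_pow (p := 2) (n := 1) (fun h => ?_) (RelIso.ext (by decide))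
  exact absurd (RelIso.ext_iff.1 h 0) (by decide)

theorem isDihedralPair_rot_refl : IsDihedralPair 4 rot refl where
  orderOf_eq := orderOf_rot
  mul_self := RelIso.ext (by decide)
  conj_eq_inv := RelIso.ext (by decide)
  notMem_zpowers h := by
    obtain ⟨k, hk⟩ := Subgroup.mem_zpowers_iff.1 h
    have hcomm : rot * refl = refl * rot := hk ▸ (Commute.refl rot).zpow_right k
    exact absurd (RelIso.ext_iff.1 hcomm 0) (by decide)

theorem swap_notMem_closure : swap ∉ Subgroup.closure {rot, refl} := by
  have hle : Subgroup.closure {rot, refl} ≤ MulAction.stabilizer (graph ≃g graph) (6 : Fin 8) := by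
    rw [Subgroup.closure_le, Set.pair_subset_iff]
    exact ⟨rfl, rfl⟩
  exact fun h => absurd (hle h) (by decide)

theorem apply_eq_self {f : graph ≃g graph} {a : Fin 8} (S : Finset (Fin 8)) (hS : ∀ b ∈ S, f b = b)
    (ha : ∀ y, (∀ b ∈ S, (graph.Adj y b ↔ graph.Adj a b) ∧ (y = b ↔ a = b)) → y = a) :
    f a = a := by
  refine ha (f a) fun b hb => ?_
  have hadj : graph.Adj (f a) (f b) ↔ graph.Adj a b := f.map_adj_iff
  have heq : f a = f b ↔ a = b := f.injective.eq_iff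
  rw [hS b hb] at hadj heq
  exact ⟨hadj, heq⟩

theorem eq_one_of_apply_eq {f : graph ≃g graph} (h0 : f 0 = 0) (h2 : f 2 = 2) (h6 : f 6 = 6) :
    f = 1 := by
  have hS : ∀ b ∈ ({0, 2, 6} : Finset (Fin 8)), f b = b := by simp [h0, h2, h6]
  have h4 : f 4 = 4 := apply_eq_self _ hS (by decide)
  have h5 : f 5 = 5 := apply_eq_self _ hS (by decide)
  have h7 : f 7 = 7 := apply_eq_self _ hS (by decide)
  have h1 : f 1 = 1 := apply_eq_self {0, 4} (by simp [h0, h4]) (by decide)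
  have h3 : f 3 = 3 := apply_eq_self {2, 5} (by simp [h2, h5]) (by decide)
  ext1 a
  fin_cases a
  exacts [h0, h1, h2, h3, h4, h5, h6, h7]

theorem exists_mul_apply_eq (f : graph ≃g graph) : ∃ (i : Fin 4) (j k : Fin 2),
    (rot ^ (i : ℕ) * refl ^ (j : ℕ) * swap ^ (k : ℕ)) 0 = f 0 ∧
    (rot ^ (i : ℕ) * refl ^ (j : ℕ) * swap ^ (k : ℕ)) 2 = f 2 ∧
    (rot ^ (i : ℕ) * refl ^ (j : ℕ) * swap ^ (k : ℕ)) 6 = f 6 := by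
  have hadj : ∀ {a b}, graph.Adj a b → graph.Adj (f a) (f b) := f.map_adj_iff.2
  have hnadj : ∀ {a b}, ¬ graph.Adj a b → ¬ graph.Adj (f a) (f b) := mt f.map_adj_iff.1
  -- Adjacency to `4` and `5` tells the pairs `{0, 1}` and `{2, 3}` apart.
  have hdecide : ∀ a d, graph.Adj d a → ∀ b, ¬ graph.Adj d b → ∀ e, graph.Adj e b →
      ¬ graph.Adj e a → ∀ c, graph.Adj c a → graph.Adj c b → ∃ (i : Fin 4) (j k : Fin 2),
        (rot ^ (i : ℕ) * refl ^ (j : ℕ) * swap ^ (k : ℕ)) 0 = a ∧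
        (rot ^ (i : ℕ) * refl ^ (j : ℕ) * swap ^ (k : ℕ)) 2 = b ∧
        (rot ^ (i : ℕ) * refl ^ (j : ℕ) * swap ^ (k : ℕ)) 6 = c := by
    decide
  exact hdecide (f 0) (f 4) (hadj (by decide)) (f 2) (hnadj (by decide)) (f 5) (hadj (by decide))
    (hnadj (by decide)) (f 6) (hadj (by decide)) (hadj (by decide))

theorem closure_eq_top : Subgroup.closure {rot, refl, swap} = ⊤ := by
  rw [eq_top_iff]
  intro f _
  obtain ⟨i, j, k, h0, h2, h6⟩ := exists_mul_apply_eq f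
  have hrot : rot ∈ Subgroup.closure {rot, refl, swap} := Subgroup.subset_closure (by simp)
  have hrefl : refl ∈ Subgroup.closure {rot, refl, swap} := Subgroup.subset_closure (by simp)
  have hswap : swap ∈ Subgroup.closure {rot, refl, swap} := Subgroup.subset_closure (by simp)
  have hmem := mul_mem (mul_mem (pow_mem hrot i) (pow_mem hrefl j)) (pow_mem hswap k)
  set g := rot ^ (i : ℕ) * refl ^ (j : ℕ) * swap ^ (k : ℕ)
  have hfix : ∀ {a}, g a = f a → (g⁻¹ * f) a = a := fun {a} h => by
    rw [RelIso.mul_apply, ← h, RelIso.inv_apply_self]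
  rwa [← inv_mul_eq_one.1 (eq_one_of_apply_eq (hfix h0) (hfix h2) (hfix h6))]

theorem nonempty_mulEquiv : Nonempty (YokeAut 1 3 ≃* DihedralGroup 4 × CyclicTwo) :=
  (isDihedralPair_rot_refl.nonempty_mulEquiv_prod (t := swap) (RelIso.ext (by decide))
    (RelIso.ext (by decide)) (RelIso.ext (by decide)) swap_notMem_closure closure_eq_top).map
    autEquiv.trans

end YokeOneThree

/-! ### Isomorphism types -/

section SmallCases

theorem nonempty_mulEquiv_cyclicTwo_of_zpowers {G : Type*} [Group G] {t : G} (ht : orderOf t = 2)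
    (htop : Subgroup.zpowers t = ⊤) : Nonempty (G ≃* CyclicTwo) :=
  nonempty_mulEquiv_cyclicTwo ((orderOf_eq_card_of_zpowers_eq_top htop).symm.trans ht)

theorem nonempty_yokeAut_one_zero : Nonempty (YokeAut 1 0 ≃* Unit) := by
  have hvertex : Subsingleton (YokeVertex 1 0) :=
    ⟨fun u v => ext_bit (Subsingleton.elim _ _) (by omega)⟩
  have haut : Unique (YokeAut 1 0) := ⟨⟨1⟩, fun f => RelIso.ext fun v => Subsingleton.elim _ _⟩
  exact ⟨MulEquiv.ofUnique⟩

theorem yokeTau_zero_eq_yokePsi (n : ℕ) : yokeTau n 0 = yokePsi n 0 := by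
  ext1 v
  rw [← zeroWord_right v, yokePsi_zeroWord]
  refine ext_bit ?_ (by omega)
  change -(zeroWord 0 v.right).left = (zeroWord 0 (-v.right)).left
  simp [zeroWord]

theorem closure_yokePhi_yokePsi_zero (n : ℕ) :
    Subgroup.closure {yokePhi n 0, yokePsi n 0} = ⊤ := by
  rw [← yokeFundamental_eq_top (n := n) (m := 0) (by omega) (by simp), yokeFundamental,
    yokeTau_zero_eq_yokePsi, Set.pair_eq_singleton]

theorem nonempty_yokeAut_zero {n : ℕ} (hn1 : n ≠ 1) (hn2 : n ≠ 2) :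
    Nonempty (YokeAut n 0 ≃* DihedralGroup n) :=
  (isDihedralPair_yokePhi_yokePsi (.inr ⟨hn1, .inr hn2⟩)).nonempty_mulEquiv
    (closure_yokePhi_yokePsi_zero n)

theorem nonempty_yokeAut_two_zero : Nonempty (YokeAut 2 0 ≃* CyclicTwo) := by
  have hψ : yokePsi 2 0 = 1 := by
    ext1 v
    rw [← zeroWord_right v, yokePsi_zeroWord, ZMod.neg_eq_self_mod_two]
    rfl
  refine nonempty_mulEquiv_cyclicTwo_of_zpowers (orderOf_yokePhi 2 0) ?_
  rw [← closure_yokePhi_yokePsi_zero, hψ, Set.pair_comm, Subgroup.closure_insert_one,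
    Subgroup.zpowers_eq_closure]

theorem nonempty_yokeAut_one_one : Nonempty (YokeAut 1 1 ≃* CyclicTwo) := by
  have hφ : yokePhi 1 1 = 1 := orderOf_eq_one_iff.1 (orderOf_yokePhi 1 1)
  have hψ : yokePsi 1 1 = 1 := by
    ext1 v
    refine ext_bit (Subsingleton.elim _ _) fun k hk => (bit_reverse v hk).trans ?_
    rw [show 1 - 1 - k = k by omega]
    rfl
  have hτ : yokeTau 1 1 ≠ 1 := fun h =>
    yokeTau_zeroWord_ne le_rfl 0 0 (RelIso.ext_iff.1 h (zeroWord 1 0))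
  refine nonempty_mulEquiv_cyclicTwo_of_zpowers
    (orderOf_eq_prime (by rw [pow_two, yokeTau_mul_self]) hτ) ?_
  rw [← yokeFundamental_eq_top (n := 1) (m := 1) (by omega) (by simp), yokeFundamental, hφ, hψ,
    Subgroup.closure_insert_one, Subgroup.closure_insert_one, Subgroup.zpowers_eq_closure]

theorem nonempty_yokeAut_one {m : ℕ} (hm : 2 ≤ m) (htop : yokeFundamental 1 m = ⊤) :
    Nonempty (YokeAut 1 m ≃* CyclicTwo × CyclicTwo) := by
  obtain ⟨e⟩ := (yokeRelations (.inl hm) htop).nonempty_mulEquiv_dihedral (.inl odd_one)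
  obtain ⟨e'⟩ : Nonempty (DihedralGroup 2 ≃* CyclicTwo × CyclicTwo) := IsKleinFour.nonempty_mulEquiv
  exact ⟨e.trans e'⟩

end SmallCases

/-- The new case is `n = 0`: as `ZMod 0` is `ℤ`, it concerns infinite Yoke graphs, and
`DihedralGroup 0` is the infinite dihedral group. -/
theorem mainTheorem6_general :
    Nonempty (YokeAut 1 3 ≃* DihedralGroup 4 × CyclicTwo) ∧
    ∀ n m : ℕ, m ≠ 2 → (n, m) ≠ (1, 3) →
      yokeFundamental n m = ⊤ ∧
      (n = 1 → m = 0 → Nonempty (YokeAut n m ≃* Unit)) ∧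
      (n = 2 → m = 0 → Nonempty (YokeAut n m ≃* CyclicTwo)) ∧
      (n = 1 → m = 1 → Nonempty (YokeAut n m ≃* CyclicTwo)) ∧
      (n ≠ 1 → n ≠ 2 → m = 0 → Nonempty (YokeAut n m ≃* DihedralGroup n)) ∧
      (n = 1 → 1 < m → Nonempty (YokeAut n m ≃* CyclicTwo × CyclicTwo)) ∧
      (n ≠ 1 → 0 < m → (Odd n ∨ Odd m) →
        Nonempty (YokeAut n m ≃* DihedralGroup (2 * n))) ∧
      (n ≠ 1 → 0 < m → Even m → Nonempty (YokeAut n m ≃* DihedralGroup n × CyclicTwo)) := by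
  refine ⟨YokeOneThree.nonempty_mulEquiv, fun n m hm2 hnm => ?_⟩
  have htop := yokeFundamental_eq_top hm2 hnm
  refine ⟨htop, ?_, ?_, ?_, ?_, ?_, ?_, ?_⟩
  · rintro rfl rfl
    exact nonempty_yokeAut_one_zero
  · rintro rfl rfl
    exact nonempty_yokeAut_two_zero
  · rintro rfl rfl
    exact nonempty_yokeAut_one_one
  · rintro hn1 hn2 rfl
    exact nonempty_yokeAut_zero hn1 hn2
  · rintro rfl hm
    exact nonempty_yokeAut_one hm htop
  · exact fun hn hm hodd => (yokeRelations (.inr ⟨hn, hm⟩) htop).nonempty_mulEquiv_dihedral hodd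
  · exact fun hn hm heven => (yokeRelations (.inr ⟨hn, hm⟩) htop).nonempty_mulEquiv_prod heven

theorem mainTheorem6 :
    Nonempty (YokeAut 1 3 ≃* DihedralGroup 4 × CyclicTwo) ∧
    ∀ n m : ℕ, 1 ≤ n → m ≠ 2 → (n, m) ≠ (1, 3) →
      yokeFundamental n m = ⊤ ∧
      (n = 1 → m = 0 → Nonempty (YokeAut n m ≃* Unit)) ∧
      (n = 2 → m = 0 → Nonempty (YokeAut n m ≃* CyclicTwo)) ∧
      (n = 1 → m = 1 → Nonempty (YokeAut n m ≃* CyclicTwo)) ∧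
      (2 < n → m = 0 → Nonempty (YokeAut n m ≃* DihedralGroup n)) ∧
      (n = 1 → 1 < m → Nonempty (YokeAut n m ≃* CyclicTwo × CyclicTwo)) ∧
      (1 < n → 0 < m → (Odd n ∨ Odd m) →
        Nonempty (YokeAut n m ≃* DihedralGroup (2 * n))) ∧
      (1 < n → 0 < m → Even n → Even m →
        Nonempty (YokeAut n m ≃* DihedralGroup n × CyclicTwo)) := by
  refine mainTheorem6_general.imp id fun H n m _ hm2 hnm => ?_
  obtain ⟨htop, h10, h20, h11, hn0, h1m, hodd, heven⟩ := H n m hm2 hnm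
  exact ⟨htop, h10, h20, h11, fun hn => hn0 (by omega) (by omega), h1m,
    fun hn => hodd (by omega), fun hn hm _ => heven (by omega) hm⟩
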